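/- Let $\lambda$ be the Liouville function, $\lambda(n)=(-1)^{\Omega(n)}$ for $n\ge 1$, where $\Omega(n)$ is the number of prime factors of $n$ counted with multiplicity, and write $e(x)=e^{2\pi i x}$. For every $\varepsilon>0$ there is a constant $c=c(\varepsilon)>0$ such that for every real number $X\ge 1$, $$\int_0^1\Big|\sum_{1\le n\le X}\lambda(n)e(n\alpha)\Big|\,d\alpha\ \ge\ c\,X^{1/4-\varepsilon}.$$ -/

import Mathlib

/-- The additive character `e(x) = exp(2πix)` on the real line. -/
noncomputable def addExp (x : ℝ) : ℂ :=
  Complex.exp (2 * (Real.pi : ℂ) * Complex.I * (x : ℂ))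

/-- The exponential sum `S(α; X) = ∑_{n ≤ X} λ(n) e(nα)` over positive integers `n`, where
`λ` is the Liouville function. -/
noncomputable def liouvilleExpSum (X α : ℝ) : ℂ :=
  ∑ n ∈ Finset.Icc 1 ⌊X⌋₊, (ArithmeticFunction.liouville n : ℂ) * addExp ((n : ℝ) * α)

/-!
The proof is elementary: it uses neither zeros of `ζ` nor the prime number theorem. Write `M(Y)` for the
smoothed sum `∑ λ(n) w(n / Y)` (`smoothSum`), where `w` is a smooth weight supported on `[0, 1]`, and
`S` for the exponential sum of length `X`.

*Why the smoothed sums cannot all be small.* Since `∑_{d ∣ k} λ(d)` is the indicator of the squares,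
the alternating sum `∑ₘ (-1)ᵐ M(Y / m)` equals `2 T(Y / 2) - T(Y)` with `T(Y) = ∑ⱼ w(j² / Y)`. As
`T(Y) = κ √Y + O(1)` with `κ > 0`, it is `κ (√2 - 1) √Y + O(1)`. The signs `(-1)ᵐ` oscillate against a
smooth function of `m`, so that repeated summation by parts truncates the sum smoothly to
`m ≤ 2 X ^ η` with an error `O(1)` (`exists_abs_sum_cutoff_smoothSum_sub_le`).

*Bringing in the fractions `a / p`.* For a prime `p`, complete multiplicativity gives
`∑_{0 < a < p} ∑ₙ λ(n) w(n / Y) e(a n / p) = -(M(Y) + p M(Y / p))`. The main terms `√Y` and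
`p √(Y / p)` have the same sign, so by the previous paragraph the numbers
`|M(X / m) + p M(X / (m p))|` add up to at least a constant times `√(p X)` over `m ≤ 2 X ^ η`, for
every prime `p ≤ √X` (`exists_mul_sqrt_mul_sqrt_le_sum`).

*Comparing with the `L¹` norm.* The smoothed sum at `a / p` is the convolution of `S` with a kernel
of size `O(Y / (1 + Y² ‖θ‖²))`. The fractions `a / p` with `p ≤ √X` are `1 / X`-separated modulo `1`,
so the sum over all of them is `O(X ‖S‖₁)` for each `Y ≤ X` (`exists_sum_prime_abs_smoothSum_le`).

Together, `√X ∑_{p ≤ √X} √p ≪ X ^ (1 + η) ‖S‖₁`, and Chebyshev's bound makes the sum over primes at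
least `X ^ (3 / 4 - 3 η / 4)` up to a constant. This is the claim for large `X`; for bounded `X` the
first Fourier coefficient of `S`, which is `λ(1) = 1`, is enough.
-/

/-! ### Finite differences and summation by parts -/

/-- Each forward difference enlarges the support of `f` by `1` to the left only. -/
theorem fwdDiff_iter_one_eq_zero {f : ℝ → ℝ} {Y : ℝ} (h0 : ∀ x ≤ 0, f x = 0)
    (hY : ∀ x, Y ≤ x → f x = 0) (A : ℕ) :
    (∀ x ≤ -(A : ℝ), (fwdDiff 1)^[A] f x = 0) ∧ ∀ x, Y ≤ x → (fwdDiff 1)^[A] f x = 0 := by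
  induction A with
  | zero => simpa using ⟨h0, hY⟩
  | succ A ih =>
    rw [Function.iterate_succ_apply']
    refine ⟨fun x hx => ?_, fun x hx => ?_⟩
    · push_cast at hx
      simp only [fwdDiff]
      rw [ih.1 _ (by linarith), ih.1 _ (by linarith), sub_zero]
    · simp only [fwdDiff]
      rw [ih.2 _ (by linarith), ih.2 _ hx, sub_zero]

/-- The mean value theorem, iterated. -/
theorem abs_fwdDiff_iter_le {A : ℕ} {f : ℝ → ℝ} (hf : ContDiff ℝ A f) {B : ℝ}
    (hB : ∀ x, |iteratedDeriv A f x| ≤ B) (x : ℝ) : |(fwdDiff 1)^[A] f x| ≤ B := by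
  induction A generalizing f with
  | zero => simpa using hB x
  | succ A ih =>
    rw [Function.iterate_succ_apply]
    have hfA : ContDiff ℝ A f := hf.of_le (by exact_mod_cast Nat.le_succ A)
    have hsh : ContDiff ℝ A (fun y => f (y + 1)) := hfA.comp (contDiff_id.add contDiff_const)
    refine ih (hsh.sub hfA) fun y => ?_
    have e : iteratedDeriv A (fwdDiff 1 f) y = iteratedDeriv A f (y + 1) - iteratedDeriv A f y := by
      have := iteratedDeriv_sub (hsh.contDiffAt (x := y)) hfA.contDiffAt
      rw [iteratedDeriv_comp_add_const] at this
      exact this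
    rw [e]
    have hd : Differentiable ℝ (iteratedDeriv A f) :=
      hf.differentiable_iteratedDeriv A (by exact_mod_cast Nat.lt_succ_self A)
    have := Convex.norm_image_sub_le_of_norm_deriv_le (f := iteratedDeriv A f) (C := B)
      (s := Set.univ) (x := y) (y := y + 1) (fun z _ => hd z)
      (fun z _ => by rw [← iteratedDeriv_succ]; exact hB z) convex_univ trivial trivial
    simpa using this

/-- Iterated summation by parts over `ℤ`: shifting the index multiplies the twisted sum by `z`, so
the sum twisted by `z ^ m` of the difference of `f` is, up to a factor of modulus one, `1 - z` times
that of `f`. -/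
theorem norm_one_sub_pow_mul_norm_tsum_le {z : ℂ} (hz : ‖z‖ = 1) (A : ℕ) {f : ℝ → ℝ}
    (hf : (Function.support fun m : ℤ => f m).Finite) :
    ‖1 - z‖ ^ A * ‖∑' m : ℤ, z ^ m * (f m : ℂ)‖ ≤ ∑' m : ℤ, |(fwdDiff 1)^[A] f m| := by
  have hz0 : z ≠ 0 := by rintro rfl; simp at hz
  induction A generalizing f with
  | zero =>
    have hs : Summable fun m : ℤ => |f m| := by
      apply summable_of_hasFiniteSupport
      refine hf.subset fun m hm => ?_
      simpa using hm
    have e : ∀ m : ℤ, ‖z ^ m * (f m : ℂ)‖ = |f m| := fun m => by simp [norm_zpow, hz]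
    have h := norm_tsum_le_tsum_norm (f := fun m : ℤ => z ^ m * (f m : ℂ)) (by simpa only [e] using hs)
    simp only [e] at h
    simpa using h
  | succ A ih =>
    rw [Function.iterate_succ_apply]
    have hf1 : (Function.support fun m : ℤ => f ((m : ℝ) + 1)).Finite := by
      have : (Function.support fun m : ℤ => f ((m : ℝ) + 1)) =
          (Equiv.addRight (1 : ℤ)) ⁻¹' (Function.support fun m : ℤ => f m) := by
        ext m; simp
      rw [this]
      exact hf.preimage (Equiv.injective _).injOn
    have hg : (Function.support fun m : ℤ => fwdDiff 1 f (m : ℝ)).Finite :=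
      (hf1.union hf).subset (Function.support_sub _ _)
    refine le_trans ?_ (ih hg)
    rw [pow_succ, mul_assoc]
    refine mul_le_mul_of_nonneg_left ?_ (by positivity)
    have s0 : Summable fun m : ℤ => z ^ m * (f m : ℂ) := by
      apply summable_of_hasFiniteSupport
      refine hf.subset fun m hm => ?_
      have : z ^ m * (f m : ℂ) ≠ 0 := hm
      simp only [Function.mem_support]
      intro h; simp [h] at this
    have s1 : Summable fun m : ℤ => z ^ m * (f ((m : ℝ) + 1) : ℂ) := by
      apply summable_of_hasFiniteSupport
      refine hf1.subset fun m hm => ?_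
      have : z ^ m * (f ((m : ℝ) + 1) : ℂ) ≠ 0 := hm
      simp only [Function.mem_support]
      intro h; simp [h] at this
    have e1 : z * ∑' m : ℤ, z ^ m * (f ((m : ℝ) + 1) : ℂ) = ∑' m : ℤ, z ^ m * (f m : ℂ) := by
      rw [← tsum_mul_left, ← (Equiv.addRight (1 : ℤ)).tsum_eq fun m : ℤ => z ^ m * (f m : ℂ)]
      refine tsum_congr fun m => ?_
      simp only [Equiv.coe_addRight, zpow_add_one₀ hz0, Int.cast_add, Int.cast_one]
      ring
    have e2 : z * ∑' m : ℤ, z ^ m * ((fwdDiff 1 f (m : ℝ) : ℝ) : ℂ) =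
        (1 - z) * ∑' m : ℤ, z ^ m * (f m : ℂ) := by
      have : ∀ m : ℤ, z ^ m * ((fwdDiff 1 f (m : ℝ) : ℝ) : ℂ) =
          z ^ m * (f ((m : ℝ) + 1) : ℂ) - z ^ m * (f m : ℂ) := fun m => by
        simp only [fwdDiff]; push_cast; ring
      rw [tsum_congr this, s1.tsum_sub s0, mul_sub, e1]; ring
    have e3 := congrArg norm e2
    rw [norm_mul, norm_mul, hz, one_mul] at e3
    exact e3.ge

/-- Summation by parts, iterated `A` times, for a smooth weight supported on `(0, Y)`: the sum of
`z ^ m * f m` is small unless `z` is close to `1`. -/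
theorem norm_one_sub_pow_mul_norm_sum_le {z : ℂ} (hz : ‖z‖ = 1) {A : ℕ} {f : ℝ → ℝ}
    (hf : ContDiff ℝ A f) {B Y : ℝ} (hB : ∀ x, |iteratedDeriv A f x| ≤ B) (hY0 : 0 < Y)
    (h0 : ∀ x ≤ 0, f x = 0) (hY : ∀ x, Y ≤ x → f x = 0) {K : ℕ} (hK : Y < K + 1) :
    ‖1 - z‖ ^ A * ‖∑ m ∈ Finset.Icc 1 K, z ^ m * (f m : ℂ)‖ ≤ (Y + A) * B := by
  have hfin : (Function.support fun m : ℤ => f m).Finite := by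
    refine (Set.finite_Ioo (0 : ℤ) ⌈Y⌉).subset fun m hm => ?_
    simp only [Function.mem_support] at hm
    refine ⟨?_, ?_⟩
    · by_contra h
      exact hm (h0 _ (by exact_mod_cast not_lt.1 h))
    · rw [Int.lt_ceil]
      by_contra h
      exact hm (hY _ (not_lt.1 h))
  have e : ∑ m ∈ Finset.Icc 1 K, z ^ m * (f m : ℂ) = ∑' m : ℤ, z ^ m * (f m : ℂ) := by
    rw [tsum_eq_sum (s := (Finset.Icc 1 K).map Nat.castEmbedding)]
    · simp
    · intro m hm
      have : f m = 0 := by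
        rcases le_or_gt m 0 with h | h
        · exact h0 _ (by exact_mod_cast h)
        · lift m to ℕ using h.le
          apply hY
          have h1 : ¬ (1 ≤ m ∧ m ≤ K) := by
            intro h'
            apply hm
            simp only [Finset.mem_map, Finset.mem_Icc]
            exact ⟨m, h', rfl⟩
          have : K + 1 ≤ m := by omega
          have : (K : ℝ) + 1 ≤ m := by exact_mod_cast this
          push_cast
          linarith
      simp [this]
  rw [e]
  refine (norm_one_sub_pow_mul_norm_tsum_le hz A hfin).trans ?_
  have hz := fwdDiff_iter_one_eq_zero h0 hY A
  have hb := abs_fwdDiff_iter_le hf hB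
  have hB0 : 0 ≤ B := (abs_nonneg _).trans (hB 0)
  rw [tsum_eq_sum (s := Finset.Ioo (-(A : ℤ)) ⌈Y⌉)]
  · refine (Finset.sum_le_card_nsmul _ (fun m : ℤ => |(fwdDiff 1)^[A] f m|) B fun m _ => hb m).trans ?_
    rw [nsmul_eq_mul, Int.card_Ioo]
    refine mul_le_mul_of_nonneg_right ?_ hB0
    have h1 : 0 < ⌈Y⌉ := Int.ceil_pos.2 hY0
    have h2 : (0 : ℤ) ≤ ⌈Y⌉ - -(A : ℤ) - 1 := by omega
    have h3 : (((⌈Y⌉ - -(A : ℤ) - 1).toNat : ℕ) : ℝ) = ⌈Y⌉ - -(A : ℝ) - 1 := by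
      have := Int.toNat_of_nonneg h2
      have : (((⌈Y⌉ - -(A : ℤ) - 1).toNat : ℤ) : ℝ) = ((⌈Y⌉ - -(A : ℤ) - 1 : ℤ) : ℝ) := by rw [this]
      push_cast at this ⊢
      exact this
    rw [h3]
    have := Int.ceil_lt_add_one Y
    linarith
  · intro m hm
    rw [abs_eq_zero]
    rw [Finset.mem_Ioo, not_and_or, not_lt, not_lt] at hm
    rcases hm with hm | hm
    · exact hz.1 _ (by exact_mod_cast hm)
    · exact hz.2 _ (Int.ceil_le.1 hm)

/-! ### The smooth weight and the smooth cutoff -/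

/-- The weight in the sums over `n`: a smooth bump supported on `[0, 1]`, equal to `1` on
`[1/4, 3/4]`. -/
noncomputable def weight : ContDiffBump (1 / 2 : ℝ) := ⟨1 / 4, 1 / 2, by norm_num, by norm_num⟩

/-- The cutoff in the sums over `m`: a smooth even bump equal to `1` on `[-1, 1]` and supported on
`[-2, 2]`. -/
noncomputable def cutoff : ContDiffBump (0 : ℝ) := ⟨1, 2, by norm_num, by norm_num⟩

theorem weight_of_nonpos {x : ℝ} (hx : x ≤ 0) : weight x = 0 := by
  apply weight.zero_of_le_dist
  rw [Real.dist_eq, abs_of_neg (by linarith)]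
  simp only [weight]; linarith

theorem weight_of_one_le {x : ℝ} (hx : 1 ≤ x) : weight x = 0 := by
  apply weight.zero_of_le_dist
  rw [Real.dist_eq, abs_of_pos (by linarith)]
  simp only [weight]; linarith

theorem cutoff_eq_one {x : ℝ} (h0 : 0 ≤ x) (hx : x ≤ 1) : cutoff x = 1 := by
  apply cutoff.one_of_mem_closedBall
  rw [mem_closedBall_iff_norm, Real.norm_eq_abs, abs_le]
  simp only [cutoff]; constructor <;> linarith

theorem cutoff_of_two_le {x : ℝ} (hx : 2 ≤ x) : cutoff x = 0 := by
  apply cutoff.zero_of_le_dist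
  rw [Real.dist_eq, abs_of_pos (by linarith)]
  simp only [cutoff]; linarith

theorem exists_forall_abs_iteratedDeriv_le {c : ℝ} (f : ContDiffBump c) (A : ℕ) :
    ∃ C : ℝ, 0 < C ∧ ∀ x, |iteratedDeriv A f x| ≤ C := by
  obtain ⟨C, hC⟩ := Continuous.bounded_above_of_compact_support
    (f := iteratedFDeriv ℝ A f)
    ((f.contDiff (n := (A : ℕ∞))).continuous_iteratedFDeriv le_rfl)
    (f.hasCompactSupport.iteratedFDeriv A)
  refine ⟨|C| + 1, by positivity, fun x => ?_⟩
  have := hC x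
  rw [norm_iteratedFDeriv_eq_norm_iteratedDeriv, Real.norm_eq_abs] at this
  linarith [le_abs_self C]

theorem contDiff_weight (A : ℕ) : ContDiff ℝ A weight := weight.contDiff (n := (A : ℕ∞))

theorem contDiff_cutoff (A : ℕ) : ContDiff ℝ A cutoff := cutoff.contDiff (n := (A : ℕ∞))

theorem iteratedDeriv_comp_div {A : ℕ} {f : ℝ → ℝ} (hf : ContDiff ℝ A f) (N x : ℝ) :
    iteratedDeriv A (fun x => f (x / N)) x = iteratedDeriv A f (x / N) / N ^ A := by
  have := congrFun (iteratedDeriv_comp_const_mul hf N⁻¹) x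
  simp only [inv_mul_eq_div] at this
  rw [this, inv_pow, inv_mul_eq_div]

/-- The derivatives of `(1 - cutoff t) * weight (s * t)` are bounded uniformly in `s ∈ [0, 1]`. -/
theorem exists_forall_abs_iteratedDeriv_tail_le (A : ℕ) :
    ∃ C : ℝ, 0 < C ∧ ∀ s : ℝ, 0 ≤ s → s ≤ 1 → ∀ x,
      |iteratedDeriv A (fun t => (1 - cutoff t) * weight (s * t)) x| ≤ C := by
  choose C hC0 hC using exists_forall_abs_iteratedDeriv_le weight
  choose D hD0 hD using exists_forall_abs_iteratedDeriv_le cutoff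
  refine ⟨C A + ∑ i ∈ Finset.range (A + 1), (A.choose i) * D i * C (A - i), ?_, fun s hs0 hs1 x => ?_⟩
  · have : 0 ≤ ∑ i ∈ Finset.range (A + 1), (A.choose i) * D i * C (A - i) :=
      Finset.sum_nonneg fun i _ => mul_nonneg (mul_nonneg (by positivity) (hD0 i).le) (hC0 _).le
    linarith [hC0 A]
  have hw (i : ℕ) : ContDiff ℝ i fun t => weight (s * t) :=
    (contDiff_weight i).comp (contDiff_const.mul contDiff_id)
  have hwb (i : ℕ) : |iteratedDeriv i (fun t => weight (s * t)) x| ≤ C i := by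
    rw [congrFun (iteratedDeriv_comp_const_mul (contDiff_weight i) s) x, abs_mul, abs_pow,
      abs_of_nonneg hs0]
    calc s ^ i * |iteratedDeriv i weight (s * x)| ≤ 1 * C i :=
          mul_le_mul (pow_le_one₀ hs0 hs1) (hC i _) (abs_nonneg _) zero_le_one
      _ = C i := one_mul _
  have hm : ContDiff ℝ A ((cutoff : ℝ → ℝ) * fun t => weight (s * t)) := (contDiff_cutoff A).mul (hw A)
  have e : (fun t => (1 - cutoff t) * weight (s * t)) =
      (fun t => weight (s * t)) - (cutoff * fun t => weight (s * t)) := by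
    ext t; simp [sub_mul]
  rw [e, iteratedDeriv_sub (hw A).contDiffAt hm.contDiffAt,
    iteratedDeriv_mul (contDiff_cutoff A).contDiffAt (hw A).contDiffAt]
  refine (abs_sub _ _).trans (add_le_add (hwb A) ?_)
  refine (Finset.abs_sum_le_sum_abs _ _).trans (Finset.sum_le_sum fun i _ => ?_)
  rw [abs_mul, abs_mul, Nat.abs_cast]
  exact mul_le_mul (mul_le_mul_of_nonneg_left (hD i x) (by positivity)) (hwb _) (abs_nonneg _)
    (mul_nonneg (by positivity) (hD0 i).le)

/-! ### The convolution of the Liouville function with the constant function -/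

theorem sum_divisors_liouville (k : ℕ) (hk : k ≠ 0) :
    ∑ d ∈ k.divisors, ArithmeticFunction.liouville d = if IsSquare k then 1 else 0 := by
  open ArithmeticFunction in
  have hmul : ((zeta : ArithmeticFunction ℤ) * liouville).IsMultiplicative :=
    isMultiplicative_zeta.natCast.mul isMultiplicative_liouville
  rw [← ArithmeticFunction.coe_zeta_mul_apply]
  induction k using Nat.recOnPosPrimePosCoprime with
  | zero => exact absurd rfl hk
  | one => simp [ArithmeticFunction.liouville_apply_one]
  | prime_pow p n hp hn =>
    rw [ArithmeticFunction.coe_zeta_mul_apply, Nat.sum_divisors_prime_pow hp]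
    have e (j : ℕ) : ArithmeticFunction.liouville (p ^ j) = (-1) ^ j := by
      rw [ArithmeticFunction.liouville_apply (pow_ne_zero _ hp.ne_zero),
        ArithmeticFunction.cardFactors_apply_prime_pow hp]
    simp only [e]
    rw [neg_one_geom_sum]
    have : IsSquare (p ^ n) ↔ Even n := by
      refine ⟨?_, fun h => h.isSquare_pow p⟩
      rintro ⟨r, hr⟩
      have h := congrArg (fun m => m.factorization p) hr
      have hr0 : r ≠ 0 := by
        rintro rfl
        exact pow_ne_zero n hp.ne_zero (by simpa using hr)
      simp only [Nat.factorization_mul hr0 hr0, hp.factorization_pow, Finsupp.single_eq_same,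
        Finsupp.add_apply] at h
      exact ⟨_, h⟩
    simp only [this, Nat.even_add_one, ite_not]
  | coprime a b ha hb hab iha ihb =>
    rw [hmul.map_mul_of_coprime hab, iha (by omega), ihb (by omega)]
    have : IsSquare (a * b) ↔ IsSquare a ∧ IsSquare b := by
      refine ⟨fun ⟨r, hr⟩ => ?_, fun ⟨h1, h2⟩ => h1.mul h2⟩
      rw [← pow_two] at hr
      have h1 := exists_eq_pow_of_mul_eq_pow (Nat.isUnit_iff.2 hab) hr
      have h2 := exists_eq_pow_of_mul_eq_pow (a := b) (b := a)
        (Nat.isUnit_iff.2 hab.symm) (by rw [mul_comm]; exact hr)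
      obtain ⟨s, hs⟩ := h1
      obtain ⟨t, ht⟩ := h2
      exact ⟨⟨s, by rw [hs, pow_two]⟩, ⟨t, by rw [ht, pow_two]⟩⟩
    simp only [this]
    split_ifs <;> simp_all

/-- The Dirichlet series identity `ζ(s) · (ζ(2s) / ζ(s)) = ζ(2s)`, summed against a test function. -/
theorem sum_sum_liouville_mul {F : ℕ → ℝ} {K : ℕ} (hF : ∀ k, K < k → F k = 0) :
    ∑ n ∈ Finset.Icc 1 K, (ArithmeticFunction.liouville n : ℝ) * ∑ m ∈ Finset.Icc 1 K, F (m * n) =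
      ∑ j ∈ Finset.Icc 1 K, F (j ^ 2) := by
  have h1 : ∀ n ∈ Finset.Icc 1 K, ∑ m ∈ Finset.Icc 1 K, F (m * n) =
      ∑ k ∈ Finset.Icc 1 K with n ∣ k, F k := by
    intro n hn
    rw [Finset.mem_Icc] at hn
    rw [← Finset.sum_filter_of_ne (p := fun m => m * n ≤ K)
      (fun m _ h => by by_contra h'; exact h (hF _ (not_le.1 h')))]
    refine Finset.sum_bij' (fun m _ => m * n) (fun k _ => k / n) ?_ ?_ ?_ ?_ ?_
    · intro m hm
      simp only [Finset.mem_filter, Finset.mem_Icc] at hm ⊢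
      exact ⟨⟨Nat.mul_pos hm.1.1 hn.1, hm.2⟩, dvd_mul_left _ _⟩
    · intro k hk
      simp only [Finset.mem_filter, Finset.mem_Icc] at hk ⊢
      refine ⟨⟨Nat.div_pos (Nat.le_of_dvd hk.1.1 hk.2) hn.1, (Nat.div_le_self _ _).trans hk.1.2⟩, ?_⟩
      rw [Nat.div_mul_cancel hk.2]; exact hk.1.2
    · intro m _
      exact Nat.mul_div_cancel _ hn.1
    · intro k hk
      exact Nat.div_mul_cancel (Finset.mem_filter.1 hk).2
    · intros; rfl
  rw [Finset.sum_congr rfl fun n hn => by rw [h1 n hn]]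
  simp only [Finset.mul_sum]
  rw [Finset.sum_comm' (t' := Finset.Icc 1 K) (s' := fun k => k.divisors)]
  · have h2 : ∀ k ∈ Finset.Icc 1 K, ∑ n ∈ k.divisors, (ArithmeticFunction.liouville n : ℝ) * F k =
        if IsSquare k then F k else 0 := by
      intro k hk
      rw [← Finset.sum_mul]
      have := sum_divisors_liouville k (by rw [Finset.mem_Icc] at hk; omega)
      have := congrArg (Int.cast : ℤ → ℝ) this
      push_cast at this
      rw [this]; split_ifs <;> simp
    rw [Finset.sum_congr rfl h2, ← Finset.sum_filter]
    symm
    rw [← Finset.sum_filter_of_ne (p := fun j => j ^ 2 ≤ K)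
      (fun m _ h => by by_contra h'; exact h (hF _ (not_le.1 h')))]
    refine Finset.sum_bij (fun j _ => j ^ 2) ?_ ?_ ?_ ?_
    · intro j hj
      simp only [Finset.mem_filter, Finset.mem_Icc] at hj ⊢
      exact ⟨⟨Nat.pow_pos hj.1.1, hj.2⟩, ⟨j, pow_two j⟩⟩
    · intro a _ b _ h
      exact Nat.pow_left_injective two_ne_zero h
    · rintro k hk
      simp only [Finset.mem_filter, Finset.mem_Icc] at hk
      obtain ⟨⟨hk1, hk2⟩, r, hr⟩ := hk
      refine ⟨r, ?_, by rw [hr, pow_two]⟩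
      simp only [Finset.mem_filter, Finset.mem_Icc]
      refine ⟨⟨?_, ?_⟩, by rw [pow_two, ← hr]; exact hk2⟩
      · rcases Nat.eq_zero_or_pos r with h | h
        · simp [h] at hr; omega
        · exact h
      · nlinarith
    · intros; rfl
  · intro n k
    simp only [Finset.mem_Icc, Finset.mem_filter, Nat.mem_divisors]
    constructor
    · rintro ⟨h1, h2, h3⟩
      exact ⟨⟨h3, by omega⟩, h2⟩
    · rintro ⟨⟨h1, h2⟩, h3⟩
      have := Nat.le_of_dvd h3.1 h1
      exact ⟨⟨Nat.pos_of_dvd_of_pos h1 h3.1, this.trans h3.2⟩, h3, h1⟩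

/-! ### The sum of the weight over squares -/

/-- The constant `∫₀¹ weight (t²) dt` in the main term. -/
noncomputable def squareDensity : ℝ := ∫ t in (0 : ℝ)..1, weight (t ^ 2)

theorem continuous_weight_sq : Continuous fun t : ℝ => weight (t ^ 2) :=
  weight.continuous.comp (continuous_pow 2)

theorem squareDensity_pos : 0 < squareDensity := by
  refine intervalIntegral.intervalIntegral_pos_of_pos_on
    (continuous_weight_sq.intervalIntegrable _ _) (fun x hx => ?_) one_pos
  apply weight.pos_of_mem_ball
  rw [mem_ball_iff_norm, Real.norm_eq_abs, abs_lt]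
  simp only [weight]
  constructor <;> nlinarith [hx.1, hx.2]

/-- A Riemann sum with step `1 / √Y` for the Lipschitz function `weight (t²)`. -/
theorem exists_abs_sum_weight_sq_sub_le :
    ∃ C : ℝ, 0 < C ∧ ∀ (Y : ℝ) (K : ℕ), 1 ≤ Y → Y < K + 1 →
      |∑ j ∈ Finset.Icc 1 K, weight ((j : ℝ) ^ 2 / Y) - squareDensity * √Y| ≤ C := by
  set g : ℝ → ℝ := fun t => weight (t ^ 2) with hg
  have hg1 (x : ℝ) (hx : 1 ≤ x) : g x = 0 := weight_of_one_le (by nlinarith)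
  obtain ⟨L, hL⟩ := ContDiff.lipschitzWith_of_hasCompactSupport (n := (1 : ℕ)) (𝕂 := ℝ) (f := g)
    (HasCompactSupport.intro (isCompact_Icc (a := (-1 : ℝ)) (b := 1)) fun x hx => by
      apply weight_of_one_le
      by_contra h
      exact hx (by rw [Set.mem_Icc]; constructor <;> nlinarith))
    ((contDiff_weight 1).comp (contDiff_id.pow 2)) (by norm_num)
  refine ⟨2 * L + 1, by positivity, fun Y K hY hK => ?_⟩
  have hs1 : 1 ≤ √Y := Real.one_le_sqrt.2 hY
  have hs0 : 0 < √Y := by linarith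
  set s := √Y with hs
  have hsY : s ^ 2 = Y := Real.sq_sqrt (by linarith)
  set n := ⌈s⌉₊ with hn
  have hns : s ≤ n := Nat.le_ceil s
  have hns' : (n : ℝ) < s + 1 := Nat.ceil_lt_add_one hs0.le
  have e1 : ∑ j ∈ Finset.Icc 1 K, weight ((j : ℝ) ^ 2 / Y) =
      ∑ j ∈ Finset.range n, g (((j + 1 : ℕ) : ℝ) / s) := by
    have hz (j : ℕ) (hj : s ≤ j) : weight ((j : ℝ) ^ 2 / Y) = 0 := by
      apply weight_of_one_le
      rw [one_le_div (by linarith), ← hsY]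
      exact pow_le_pow_left₀ hs0.le hj 2
    have e2 : ∑ j ∈ Finset.range n, g (((j + 1 : ℕ) : ℝ) / s) =
        ∑ j ∈ Finset.Icc 1 n, weight ((j : ℝ) ^ 2 / Y) := by
      rw [Finset.range_eq_Ico, Finset.sum_Ico_add' (fun j : ℕ => g ((j : ℝ) / s)) 0 n 1]
      simp only [zero_add, ← Finset.Ico_add_one_right_eq_Icc, hg, div_pow, hsY]
    rw [e2]
    trans ∑ j ∈ Finset.Icc 1 (max K n), weight ((j : ℝ) ^ 2 / Y)
    · apply Finset.sum_subset (Finset.Icc_subset_Icc_right (le_max_left _ _))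
      intro j hj hj'
      simp only [Finset.mem_Icc] at hj hj'
      apply hz
      have : K + 1 ≤ j := by omega
      have : (K : ℝ) + 1 ≤ j := by exact_mod_cast this
      nlinarith
    · symm
      apply Finset.sum_subset (Finset.Icc_subset_Icc_right (le_max_right _ _))
      intro j hj hj'
      simp only [Finset.mem_Icc] at hj hj'
      apply hz
      have : n ≤ j := by omega
      exact hns.trans (by exact_mod_cast this)
  have hgc : Continuous g := continuous_weight_sq
  have hgs : Continuous fun x : ℝ => g (x / s) := hgc.comp (continuous_id.div_const s)
  have e3 : squareDensity * s = ∑ j ∈ Finset.range n, ∫ x in (j : ℝ)..((j + 1 : ℕ) : ℝ), g (x / s) := by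
    rw [intervalIntegral.sum_integral_adjacent_intervals
      (fun k _ => hgs.intervalIntegrable _ _), intervalIntegral.integral_comp_div _ hs0.ne',
      Nat.cast_zero, zero_div, ← intervalIntegral.integral_add_adjacent_intervals
        (hgc.intervalIntegrable 0 1) (hgc.intervalIntegrable 1 (n / s))]
    have : ∫ x in (1 : ℝ)..(n / s), g x = 0 := by
      apply intervalIntegral.integral_zero_ae
      filter_upwards with x hx
      rw [Set.uIoc_of_le ((one_le_div hs0).2 hns)] at hx
      exact hg1 x hx.1.le
    rw [this, add_zero, smul_eq_mul, mul_comm]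
    rfl
  rw [e1, e3, ← Finset.sum_sub_distrib]
  have hterm : ∀ j ∈ Finset.range n, |g (((j + 1 : ℕ) : ℝ) / s) -
      ∫ x in (j : ℝ)..((j + 1 : ℕ) : ℝ), g (x / s)| ≤ L / s := by
    intro j _
    have : g (((j + 1 : ℕ) : ℝ) / s) = ∫ x in (j : ℝ)..((j + 1 : ℕ) : ℝ), g (((j + 1 : ℕ) : ℝ) / s) := by
      rw [intervalIntegral.integral_const]; simp
    rw [this, ← intervalIntegral.integral_sub (by simp) (hgs.intervalIntegrable _ _)]
    have := intervalIntegral.norm_integral_le_of_norm_le_const (a := (j : ℝ)) (b := ((j + 1 : ℕ) : ℝ))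
      (C := L / s) (f := fun x => g (((j + 1 : ℕ) : ℝ) / s) - g (x / s)) fun x hx => by
        rw [Set.uIoc_of_le (by simp)] at hx
        have h := hL.dist_le_mul (((j + 1 : ℕ) : ℝ) / s) (x / s)
        rw [dist_eq_norm] at h
        refine h.trans ?_
        rw [Real.dist_eq, ← sub_div, abs_div, abs_of_pos hs0, mul_div_assoc']
        refine div_le_div_of_nonneg_right ?_ hs0.le
        have h3 : |((j + 1 : ℕ) : ℝ) - x| ≤ 1 := by
          push_cast at hx ⊢
          rw [abs_le]; constructor <;> linarith [hx.1, hx.2]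
        calc (L : ℝ) * |((j + 1 : ℕ) : ℝ) - x| ≤ L * 1 := mul_le_mul_of_nonneg_left h3 L.2
          _ = L := mul_one _
    simpa using this
  refine (Finset.abs_sum_le_sum_abs _ _).trans ((Finset.sum_le_sum hterm).trans ?_)
  rw [Finset.sum_const, Finset.card_range, nsmul_eq_mul, mul_div_assoc', div_le_iff₀ hs0]
  have : (0 : ℝ) ≤ L := L.2
  nlinarith

/-! ### Alternating sums of smoothed sums of the Liouville function -/

/-- The smoothed summatory function `∑ λ(n) weight (n / Y)`. The sum runs over `n ≤ K`; all terms
beyond `Y` vanish, so that the value does not depend on `K` when `Y < K + 1`. -/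
noncomputable def smoothSum (K : ℕ) (Y : ℝ) : ℝ :=
  ∑ n ∈ Finset.Icc 1 K, (ArithmeticFunction.liouville n : ℝ) * weight (n / Y)

theorem sum_neg_one_pow_mul_eq {g : ℕ → ℝ} {K : ℕ} (hg : ∀ k, K < k → g k = 0) :
    ∑ m ∈ Finset.Icc 1 K, (-1 : ℝ) ^ m * g m =
      2 * ∑ m ∈ Finset.Icc 1 K, g (2 * m) - ∑ m ∈ Finset.Icc 1 K, g m := by
  have h (J : ℕ) : ∑ m ∈ Finset.Icc 1 (2 * J), ((-1 : ℝ) ^ m * g m + g m) =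
      2 * ∑ m ∈ Finset.Icc 1 J, g (2 * m) := by
    induction J with
    | zero => simp
    | succ J ih =>
      rw [show 2 * (J + 1) = 2 * J + 1 + 1 by ring, Finset.sum_Icc_succ_top (by omega),
        Finset.sum_Icc_succ_top (by omega), Finset.sum_Icc_succ_top (by omega), ih]
      have h1 : (-1 : ℝ) ^ (2 * J) = 1 := by rw [pow_mul]; norm_num
      have h2 : (-1 : ℝ) ^ (2 * J + 1) = -1 := by rw [pow_succ, h1]; ring
      have h3 : (-1 : ℝ) ^ (2 * J + 1 + 1) = 1 := by rw [pow_succ, h2]; ring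
      rw [h2, h3]
      ring_nf
  have h1 : ∑ m ∈ Finset.Icc 1 K, ((-1 : ℝ) ^ m * g m + g m) =
      ∑ m ∈ Finset.Icc 1 (2 * K), ((-1 : ℝ) ^ m * g m + g m) := by
    apply Finset.sum_subset (Finset.Icc_subset_Icc_right (by omega))
    intro m hm hm'
    simp only [Finset.mem_Icc] at hm hm'
    rw [hg m (by omega)]; ring
  rw [← h, ← h1, Finset.sum_add_distrib]; ring

/-- The sum over all `m` of `(-1)ᵐ M(Y / m)`, where `M` is the smoothed sum, reduces to sums over
squares, of length `Y / 2` and `Y`; this is where the main term comes from. -/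
theorem exists_abs_sum_neg_one_pow_smoothSum_sub_le :
    ∃ C : ℝ, 0 < C ∧ ∀ (Y : ℝ) (K : ℕ), 2 ≤ Y → Y < K + 1 →
      |∑ n ∈ Finset.Icc 1 K, (ArithmeticFunction.liouville n : ℝ) *
          ∑ m ∈ Finset.Icc 1 K, (-1 : ℝ) ^ m * weight (m * n / Y) -
        squareDensity * (√2 - 1) * √Y| ≤ C := by
  obtain ⟨C, hC0, hC⟩ := exists_abs_sum_weight_sq_sub_le
  refine ⟨3 * C, by positivity, fun Y K hY hK => ?_⟩
  have hF (Z : ℝ) (hZ0 : 0 < Z) (hZ : Z ≤ Y) (k : ℕ) (hk : K < k) : weight ((k : ℝ) / Z) = 0 := by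
    apply weight_of_one_le
    rw [one_le_div hZ0]
    have : (K : ℝ) + 1 ≤ k := by exact_mod_cast hk
    linarith
  have key : ∑ n ∈ Finset.Icc 1 K, (ArithmeticFunction.liouville n : ℝ) *
      ∑ m ∈ Finset.Icc 1 K, (-1 : ℝ) ^ m * weight (m * n / Y) =
      2 * ∑ j ∈ Finset.Icc 1 K, weight ((j : ℝ) ^ 2 / (Y / 2)) -
        ∑ j ∈ Finset.Icc 1 K, weight ((j : ℝ) ^ 2 / Y) := by
    have a1 := sum_sum_liouville_mul (F := fun k => weight ((k : ℝ) / Y)) (K := K)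
      (hF Y (by linarith) le_rfl)
    have a2 := sum_sum_liouville_mul (F := fun k => weight ((k : ℝ) / (Y / 2))) (K := K)
      (hF (Y / 2) (by linarith) (by linarith))
    push_cast at a1 a2
    rw [← a1, ← a2, Finset.mul_sum, ← Finset.sum_sub_distrib]
    refine Finset.sum_congr rfl fun n hn => ?_
    rw [sum_neg_one_pow_mul_eq (g := fun m => weight (m * n / Y))]
    · have (m : ℕ) : ((2 * m : ℕ) : ℝ) * n / Y = m * n / (Y / 2) := by
        push_cast; field_simp
      simp only [this]; ring
    · intro m hm
      have := hF Y (by linarith) le_rfl (m * n) (by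
        rw [Finset.mem_Icc] at hn; nlinarith)
      simpa using this
  rw [key]
  have b1 := hC Y K (by linarith) hK
  have b2 := hC (Y / 2) K (by linarith) (by linarith)
  have b3 : 2 * √(Y / 2) = √2 * √Y := by
    rw [Real.sqrt_div' _ (by norm_num : (0:ℝ) ≤ 2)]
    have : √2 * √2 = 2 := Real.mul_self_sqrt (by norm_num)
    have h2 : √2 ≠ 0 := by positivity
    field_simp
    linear_combination -this
  rw [abs_le] at *
  have b4 : squareDensity * (√2 - 1) * √Y = 2 * (squareDensity * √(Y / 2)) - squareDensity * √Y := by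
    linear_combination (-squareDensity) * b3
  constructor <;> linarith

/-- The part of the alternating sum removed by the cutoff is negligible: repeated summation by
parts over `m` gains a factor `1 / N` each time. -/
theorem exists_abs_sum_neg_one_pow_tail_le (A : ℕ) :
    ∃ C : ℝ, 0 < C ∧ ∀ (Y N : ℝ) (K n : ℕ), 0 < Y → 0 < N → Y < K + 1 → 1 ≤ n →
      |∑ m ∈ Finset.Icc 1 K, (-1 : ℝ) ^ m * ((1 - cutoff (m / N)) * weight (m * n / Y))| ≤
        C * (Y + A) / N ^ A := by
  obtain ⟨C, hC0, hC⟩ := exists_forall_abs_iteratedDeriv_tail_le A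
  refine ⟨C, hC0, fun Y N K n hY hN hK hn => ?_⟩
  set s : ℝ := n * N / Y with hs
  have hn' : (1 : ℝ) ≤ n := by exact_mod_cast hn
  have hs0 : 0 < s := by positivity
  -- If `1 < s` every term vanishes, through the cutoff for `m ≤ N` and through the weight beyond.
  rcases le_or_gt s 1 with hs1 | hs1
  · set f : ℝ → ℝ := fun x => (1 - cutoff (x / N)) * weight (s * (x / N)) with hf
    have hG : ContDiff ℝ A fun t => (1 - cutoff t) * weight (s * t) :=
      (contDiff_const.sub (contDiff_cutoff A)).mul
        ((contDiff_weight A).comp (contDiff_const.mul contDiff_id))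
    have hsx (x : ℝ) : s * (x / N) = x * n / Y := by rw [hs]; field_simp
    have hfd : ContDiff ℝ A f := hG.comp (contDiff_id.div_const N)
    have h := norm_one_sub_pow_mul_norm_sum_le (z := -1) (by simp) hfd (B := C / N ^ A) (Y := Y)
      (fun x => by
        rw [hf, iteratedDeriv_comp_div hG, abs_div, abs_of_pos (pow_pos hN A)]
        exact div_le_div_of_nonneg_right (hC s hs0.le hs1 _) (pow_pos hN A).le)
      hY (fun x hx => by
        simp only [hf]
        rw [weight_of_nonpos, mul_zero]
        exact mul_nonpos_of_nonneg_of_nonpos hs0.le (div_nonpos_of_nonpos_of_nonneg hx hN.le))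
      (fun x hx => by
        simp only [hf]
        rw [weight_of_one_le, mul_zero]
        rw [hsx, one_le_div hY]
        nlinarith)
      hK
    have e : ‖∑ m ∈ Finset.Icc 1 K, (-1 : ℂ) ^ m * (f m : ℂ)‖ =
        |∑ m ∈ Finset.Icc 1 K, (-1 : ℝ) ^ m * ((1 - cutoff (m / N)) * weight (m * n / Y))| := by
      rw [← Real.norm_eq_abs, ← Complex.norm_real]
      push_cast
      simp only [hf, hsx]
      push_cast
      rfl
    rw [e] at h
    have h2 : (1 : ℝ) ≤ ‖(1 : ℂ) - -1‖ ^ A := by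
      apply one_le_pow₀
      norm_num
    calc _ ≤ _ := le_mul_of_one_le_left (abs_nonneg _) h2
      _ ≤ _ := h
      _ = _ := by ring
  · rw [Finset.sum_eq_zero, abs_zero]
    · positivity
    · intro m _
      rcases le_or_gt (m : ℝ) N with h | h
      · rw [cutoff_eq_one (by positivity) ((div_le_one hN).2 h)]; simp
      · rw [weight_of_one_le (x := m * n / Y)]
        · simp
        · rw [one_le_div hY]
          rw [hs, lt_div_iff₀ hY] at hs1
          nlinarith

/-- The alternating sum of the smoothed sums keeps its main term when it is cut off at `m ≤ 2 N`; the
error is bounded as soon as `N ^ A` exceeds `K * Y`. -/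
theorem exists_abs_sum_cutoff_smoothSum_sub_le (A : ℕ) :
    ∃ C : ℝ, 0 < C ∧ ∀ (Y N : ℝ) (K : ℕ), 2 ≤ Y → 0 < N → Y < K + 1 →
      |∑ m ∈ Finset.Icc 1 K, (-1 : ℝ) ^ m * cutoff (m / N) * smoothSum K (Y / m) -
        squareDensity * (√2 - 1) * √Y| ≤ C * (1 + K * (Y + A) / N ^ A) := by
  obtain ⟨C₁, hC₁0, hC₁⟩ := exists_abs_sum_neg_one_pow_smoothSum_sub_le
  obtain ⟨C₂, hC₂0, hC₂⟩ := exists_abs_sum_neg_one_pow_tail_le A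
  refine ⟨C₁ + C₂, by positivity, fun Y N K hY hN hK => ?_⟩
  have h1 := hC₁ Y K hY hK
  have h2 : |∑ n ∈ Finset.Icc 1 K, (ArithmeticFunction.liouville n : ℝ) *
      ∑ m ∈ Finset.Icc 1 K, (-1 : ℝ) ^ m * ((1 - cutoff (m / N)) * weight (m * n / Y))| ≤
      K * (C₂ * (Y + A) / N ^ A) := by
    refine (Finset.abs_sum_le_sum_abs _ _).trans ?_
    have : ∀ n ∈ Finset.Icc 1 K, |(ArithmeticFunction.liouville n : ℝ) *
      ∑ m ∈ Finset.Icc 1 K, (-1 : ℝ) ^ m * ((1 - cutoff (m / N)) * weight (m * n / Y))| ≤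
        C₂ * (Y + A) / N ^ A := by
      intro n hn
      rw [Finset.mem_Icc] at hn
      rw [abs_mul, ArithmeticFunction.liouville_apply (by omega)]
      simpa using hC₂ Y N K n (by linarith) hN hK hn.1
    refine (Finset.sum_le_card_nsmul _ _ _ this).trans_eq ?_
    simp
  have h3 : ∑ m ∈ Finset.Icc 1 K, (-1 : ℝ) ^ m * cutoff (m / N) * smoothSum K (Y / m) =
      ∑ n ∈ Finset.Icc 1 K, (ArithmeticFunction.liouville n : ℝ) *
          ∑ m ∈ Finset.Icc 1 K, (-1 : ℝ) ^ m * weight (m * n / Y) -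
      ∑ n ∈ Finset.Icc 1 K, (ArithmeticFunction.liouville n : ℝ) *
      ∑ m ∈ Finset.Icc 1 K, (-1 : ℝ) ^ m * ((1 - cutoff (m / N)) * weight (m * n / Y)) := by
    simp only [smoothSum, Finset.mul_sum]
    rw [Finset.sum_comm, ← Finset.sum_sub_distrib]
    refine Finset.sum_congr rfl fun n _ => ?_
    rw [← Finset.sum_sub_distrib]
    refine Finset.sum_congr rfl fun m hm => ?_
    have : (n : ℝ) / (Y / m) = m * n / Y := by
      rw [div_div_eq_mul_div, mul_comm]
    rw [this]; ring
  rw [h3]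
  have hY0 : 0 < Y := by linarith
  have h4 : 0 ≤ (K : ℝ) * (Y + A) / N ^ A := by positivity
  have h5 : (K : ℝ) * (C₂ * (Y + A) / N ^ A) = C₂ * (K * (Y + A) / N ^ A) := by ring
  rw [h5] at h2
  rw [abs_le] at *
  constructor <;> nlinarith

/-! ### The additive character -/

theorem norm_addExp (x : ℝ) : ‖addExp x‖ = 1 := by
  have : addExp x = Complex.exp ((2 * Real.pi * x : ℝ) * Complex.I) := by
    rw [addExp]; push_cast; ring_nf
  rw [this, Complex.norm_exp_ofReal_mul_I]

theorem addExp_add (x y : ℝ) : addExp (x + y) = addExp x * addExp y := by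
  simp only [addExp, ← Complex.exp_add]; push_cast; ring_nf

theorem addExp_natCast_mul (n : ℕ) (x : ℝ) : addExp (n * x) = addExp x ^ n := by
  simp only [addExp, ← Complex.exp_nat_mul]; push_cast; ring_nf

theorem addExp_eq_one_iff {x : ℝ} : addExp x = 1 ↔ ∃ k : ℤ, x = k := by
  have h2 : (2 * Real.pi * Complex.I : ℂ) ≠ 0 := Complex.two_pi_I_ne_zero
  rw [addExp, Complex.exp_eq_one_iff]
  refine exists_congr fun k => ?_
  rw [show (2 * (Real.pi : ℂ) * Complex.I * (x : ℂ)) = x * (2 * Real.pi * Complex.I) by ring]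
  rw [mul_left_inj' h2]
  norm_cast

theorem addExp_add_intCast (x : ℝ) (k : ℤ) : addExp (x + k) = addExp x := by
  rw [addExp_add, addExp_eq_one_iff.2 ⟨k, rfl⟩, mul_one]

theorem continuous_addExp : Continuous addExp := by
  unfold addExp; fun_prop

theorem integral_addExp_intCast_mul (k : ℤ) :
    ∫ α in (0 : ℝ)..1, addExp (k * α) = if k = 0 then 1 else 0 := by
  split_ifs with h
  · subst h
    simp [addExp]
  · have hc : (2 * (Real.pi : ℂ) * Complex.I * k) ≠ 0 :=
      mul_ne_zero Complex.two_pi_I_ne_zero (by exact_mod_cast h)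
    have e : ∀ α : ℝ, addExp (k * α) = Complex.exp (2 * (Real.pi : ℂ) * Complex.I * k * α) := by
      intro α; rw [addExp]; push_cast; ring_nf
    simp only [e]
    rw [integral_exp_mul_complex hc]
    have : Complex.exp (2 * (Real.pi : ℂ) * Complex.I * k * (1 : ℝ)) = 1 := by
      rw [← e, addExp_eq_one_iff]; exact ⟨k, by simp⟩
    rw [this]; simp

theorem four_mul_abs_le_norm_one_sub_addExp {r : ℝ} (hr : |r| ≤ 1 / 2) :
    4 * |r| ≤ ‖1 - addExp r‖ := by
  have e : addExp r = Complex.exp (Complex.I * (2 * Real.pi * r : ℝ)) := by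
    rw [addExp]; push_cast; ring_nf
  rw [norm_sub_rev, e, Complex.norm_exp_I_mul_ofReal_sub_one, norm_mul, Real.norm_eq_abs,
    Real.norm_eq_abs, abs_two, show 2 * Real.pi * r / 2 = Real.pi * r by ring]
  have hpi := Real.pi_pos
  have h1 : |Real.sin (Real.pi * r)| = |Real.sin (Real.pi * |r|)| := by
    rcases abs_cases r with h | h
    · rw [h.1]
    · rw [h.1, mul_neg, Real.sin_neg, abs_neg]
  have h2 := Real.mul_le_sin (x := Real.pi * |r|) (by positivity) (by nlinarith)
  have h3 : 2 / Real.pi * (Real.pi * |r|) = 2 * |r| := by field_simp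
  rw [h1]
  linarith [le_abs_self (Real.sin (Real.pi * |r|))]

/-! ### The smoothing kernel -/

/-- The trigonometric polynomial `∑ weight (n / Y) e(n θ)`; convolving with it inserts the smooth
weight into an exponential sum. -/
noncomputable def kernel (K : ℕ) (Y θ : ℝ) : ℂ :=
  ∑ n ∈ Finset.Icc 1 K, (weight (n / Y) : ℂ) * addExp (n * θ)

theorem continuous_kernel (K : ℕ) (Y : ℝ) : Continuous (kernel K Y) := by
  unfold kernel
  exact continuous_finsetSum _ fun n _ => continuous_const.mul
    (continuous_addExp.comp (continuous_const.mul continuous_id))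

theorem continuous_liouvilleExpSum (X : ℝ) : Continuous (liouvilleExpSum X) := by
  unfold liouvilleExpSum
  exact continuous_finsetSum _ fun n _ => continuous_const.mul
    (continuous_addExp.comp (continuous_const.mul continuous_id))

/-- Convolution with the kernel at `β`, by orthogonality of the characters. -/
theorem integral_liouvilleExpSum_mul_kernel (X Y β : ℝ) :
    ∫ α in (0 : ℝ)..1, liouvilleExpSum X α * kernel ⌊X⌋₊ Y (β - α) =
      ∑ n ∈ Finset.Icc 1 ⌊X⌋₊,
        ((ArithmeticFunction.liouville n : ℝ) * weight (n / Y) : ℂ) * addExp (n * β) := by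
  simp only [liouvilleExpSum, kernel, Finset.sum_mul_sum]
  have hc (n m : ℕ) : Continuous fun α : ℝ => (ArithmeticFunction.liouville n : ℂ) *
      addExp ((n : ℝ) * α) * ((weight (m / Y) : ℂ) * addExp (m * (β - α))) :=
    (continuous_const.mul (continuous_addExp.comp (by fun_prop))).mul
      (continuous_const.mul (continuous_addExp.comp (by fun_prop)))
  rw [intervalIntegral.integral_finsetSum fun n _ =>
    (continuous_finsetSum _ fun m _ => hc n m).intervalIntegrable _ _]
  refine Finset.sum_congr rfl fun n hn => ?_
  rw [intervalIntegral.integral_finsetSum fun m _ => (hc n m).intervalIntegrable _ _]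
  have h (m : ℕ) : ∫ α in (0 : ℝ)..1, (ArithmeticFunction.liouville n : ℂ) *
      addExp ((n : ℝ) * α) * ((weight (m / Y) : ℂ) * addExp (m * (β - α))) =
      if n = m then ((ArithmeticFunction.liouville n : ℝ) * weight (n / Y) : ℂ) * addExp (n * β)
        else 0 := by
    have e (α : ℝ) : (ArithmeticFunction.liouville n : ℂ) *
        addExp ((n : ℝ) * α) * ((weight (m / Y) : ℂ) * addExp (m * (β - α))) =
        ((ArithmeticFunction.liouville n : ℂ) * weight (m / Y) * addExp (m * β)) *
          addExp (((n - m : ℤ) : ℝ) * α) := by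
      have : addExp ((n : ℝ) * α) * addExp (m * (β - α)) =
          addExp (m * β) * addExp (((n - m : ℤ) : ℝ) * α) := by
        rw [← addExp_add, ← addExp_add]; push_cast; ring_nf
      linear_combination (ArithmeticFunction.liouville n : ℂ) * weight (m / Y) * this
    simp only [e]
    rw [intervalIntegral.integral_const_mul, integral_addExp_intCast_mul]
    by_cases hnm : n = m
    · subst hnm; simp
    · rw [if_neg (by omega), if_neg hnm, mul_zero]
  simp only [h, Finset.sum_ite_eq, hn, if_true]

theorem kernel_add_intCast (K : ℕ) (Y θ : ℝ) (k : ℤ) : kernel K Y (θ + k) = kernel K Y θ := by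
  unfold kernel
  refine Finset.sum_congr rfl fun n _ => ?_
  rw [show (n : ℝ) * (θ + k) = n * θ + ((n * k : ℤ) : ℝ) by push_cast; ring, addExp_add_intCast]

theorem norm_kernel_le (K : ℕ) {Y : ℝ} (hY : 0 < Y) (θ : ℝ) : ‖kernel K Y θ‖ ≤ Y := by
  have h1 : kernel K Y θ = ∑ n ∈ Finset.Icc 1 ⌊Y⌋₊ with n ≤ K, (weight (n / Y) : ℂ) * addExp (n * θ) := by
    unfold kernel
    symm
    refine Finset.sum_subset_zero_on_sdiff ?_ ?_ fun _ _ => rfl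
    · intro n hn
      simp only [Finset.mem_filter, Finset.mem_Icc] at hn ⊢
      exact ⟨hn.1.1, hn.2⟩
    · intro n hn
      simp only [Finset.mem_sdiff, Finset.mem_filter, Finset.mem_Icc] at hn
      rw [weight_of_one_le]; · simp
      rw [one_le_div hY]
      have : ¬ n ≤ ⌊Y⌋₊ := by tauto
      exact (Nat.lt_of_floor_lt (not_le.1 this)).le
  rw [h1]
  refine (norm_sum_le _ _).trans ?_
  have : ∀ n ∈ (Finset.Icc 1 ⌊Y⌋₊).filter (· ≤ K), ‖(weight (n / Y) : ℂ) * addExp (n * θ)‖ ≤ 1 := by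
    intro n _
    rw [norm_mul, norm_addExp, mul_one, Complex.norm_real, Real.norm_eq_abs,
      abs_of_nonneg weight.nonneg]
    exact weight.le_one
  refine (Finset.sum_le_card_nsmul _ _ _ this).trans ?_
  rw [nsmul_eq_mul, mul_one]
  refine le_trans ?_ (Nat.floor_le hY.le)
  have := Finset.card_filter_le (Finset.Icc 1 ⌊Y⌋₊) (· ≤ K)
  rw [Nat.card_Icc, Nat.add_sub_cancel] at this
  exact_mod_cast this

/-- The kernel is at most `Y` trivially, and two summations by parts bound it by `O(1 / (Y r²))`. The
restriction `|r| ≤ 1 / 2` makes `|r|` the distance to the nearest integer. -/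
theorem exists_norm_kernel_le :
    ∃ C : ℝ, 0 < C ∧ ∀ (K : ℕ) (Y : ℝ), 0 < Y → Y < K + 1 → ∀ r : ℝ, |r| ≤ 1 / 2 →
      ‖kernel K Y r‖ ≤ C * (Y / (1 + (Y * r) ^ 2)) := by
  obtain ⟨C, hC0, hC⟩ := exists_forall_abs_iteratedDeriv_le weight 2
  refine ⟨1 + C, by positivity, fun K Y hY hK r hr => ?_⟩
  -- For `Y < 1` the kernel vanishes; for `Y ≥ 1` the number `Y + 2` of differences is at most `3 * Y`.
  rcases lt_or_ge Y 1 with hY1 | hY1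
  · have : kernel K Y r = 0 := by
      unfold kernel
      refine Finset.sum_eq_zero fun n hn => ?_
      rw [weight_of_one_le]; · simp
      rw [Finset.mem_Icc] at hn
      rw [one_le_div hY]
      have : (1 : ℝ) ≤ n := by exact_mod_cast hn.1
      linarith
    rw [this, norm_zero]; positivity
  have h1 := norm_kernel_le K hY r
  have h2 := norm_one_sub_pow_mul_norm_sum_le (norm_addExp r) (A := 2) (f := fun x => weight (x / Y))
    ((contDiff_weight 2).comp (contDiff_id.div_const Y)) (B := C / Y ^ 2)
    (fun x => by
      rw [iteratedDeriv_comp_div (contDiff_weight 2), abs_div, abs_of_pos (pow_pos hY 2)]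
      exact div_le_div_of_nonneg_right (hC _) (pow_pos hY 2).le) hY
    (fun x hx => weight_of_nonpos (div_nonpos_of_nonpos_of_nonneg hx hY.le))
    (fun x hx => weight_of_one_le ((one_le_div hY).2 hx)) hK
  have e : ∑ m ∈ Finset.Icc 1 K, addExp r ^ m * ((weight ((m : ℝ) / Y) : ℝ) : ℂ) = kernel K Y r := by
    unfold kernel
    refine Finset.sum_congr rfl fun n _ => ?_
    rw [addExp_natCast_mul, mul_comm]
  rw [e] at h2
  have h3 := four_mul_abs_le_norm_one_sub_addExp hr
  have h4 : 16 * r ^ 2 * ‖kernel K Y r‖ ≤ 3 * C / Y := by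
    calc 16 * r ^ 2 * ‖kernel K Y r‖ = (4 * |r|) ^ 2 * ‖kernel K Y r‖ := by
          rw [mul_pow, sq_abs]; norm_num
      _ ≤ ‖1 - addExp r‖ ^ 2 * ‖kernel K Y r‖ := by gcongr
      _ ≤ (Y + (2 : ℕ)) * (C / Y ^ 2) := h2
      _ ≤ (3 * Y) * (C / Y ^ 2) := by
          refine mul_le_mul_of_nonneg_right ?_ (by positivity)
          push_cast; linarith
      _ = 3 * C / Y := by field_simp
  rw [mul_div_assoc', le_div_iff₀ (by positivity)]
  have h5 : (Y * r) ^ 2 * ‖kernel K Y r‖ ≤ C * Y := by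
    have : Y ^ 2 * (16 * r ^ 2 * ‖kernel K Y r‖) ≤ Y ^ 2 * (3 * C / Y) := by gcongr
    have h6 : Y ^ 2 * (3 * C / Y) = 3 * (C * Y) := by field_simp
    rw [h6] at this
    have : 0 < C * Y := by positivity
    nlinarith
  nlinarith

/-! ### Well-spaced points -/

theorem inv_one_add_sq_mul_sub_le_arctan_sub {x y : ℝ} (hx : 0 ≤ x) (hxy : x ≤ y) :
    1 / (1 + y ^ 2) * (y - x) ≤ Real.arctan y - Real.arctan x := by
  refine Convex.mul_sub_le_image_sub_of_le_deriv (convex_Icc x y) Real.continuous_arctan.continuousOn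
    Real.differentiable_arctan.differentiableOn (fun z hz => ?_) x (Set.left_mem_Icc.2 hxy) y
    (Set.right_mem_Icc.2 hxy) hxy
  rw [interior_Icc] at hz
  rw [Real.deriv_arctan]
  refine one_div_le_one_div_of_le (by positivity) ?_
  nlinarith [hz.1, hz.2]

theorem sum_range_div_one_add_sq_le {Y δ : ℝ} (hY : 0 < Y) (hδ : 0 < δ) (Q : ℕ) :
    ∑ q ∈ Finset.range Q, Y / (1 + (Y * (q * δ)) ^ 2) ≤ Y + 2 / δ := by
  have h (Q : ℕ) : ∑ q ∈ Finset.range (Q + 1), Y / (1 + (Y * (q * δ)) ^ 2) ≤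
      Y + 1 / δ * Real.arctan (Y * (Q * δ)) := by
    induction Q with
    | zero => simp
    | succ Q ih =>
      rw [Finset.sum_range_succ]
      have := inv_one_add_sq_mul_sub_le_arctan_sub (x := Y * (Q * δ)) (y := Y * ((Q + 1 : ℕ) * δ))
        (by positivity) (by push_cast; nlinarith [mul_pos hY hδ])
      have h2 : Y / (1 + (Y * ((Q + 1 : ℕ) * δ)) ^ 2) =
          1 / δ * (1 / (1 + (Y * ((Q + 1 : ℕ) * δ)) ^ 2) * (Y * ((Q + 1 : ℕ) * δ) - Y * (Q * δ))) := by
        have : (Y * ((Q + 1 : ℕ) * δ) - Y * (Q * δ)) = Y * δ := by push_cast; ring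
        rw [this]; field_simp
      rw [h2]
      have h3 := mul_le_mul_of_nonneg_left this (one_div_pos.2 hδ).le
      linarith
  have h4 : Real.arctan (Y * (Q * δ)) ≤ 2 := by
    have := Real.arctan_lt_pi_div_two (Y * (Q * δ))
    linarith [Real.pi_le_four]
  calc _ ≤ ∑ q ∈ Finset.range (Q + 1), Y / (1 + (Y * (q * δ)) ^ 2) := by
        rw [Finset.sum_range_succ]
        have : 0 ≤ Y / (1 + (Y * (Q * δ)) ^ 2) := by positivity
        linarith
    _ ≤ _ := h Q
    _ ≤ Y + 1 / δ * 2 := by gcongr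
    _ = _ := by ring

/-- Separated nonnegative points lie in different intervals `[q δ, (q + 1) δ)`, which reduces the sum
to one over `q`. -/
theorem sum_div_one_add_sq_le_of_nonneg {ι : Type*} (T : Finset ι) (r : ι → ℝ) {Y δ : ℝ} (hY : 0 < Y)
    (hδ : 0 < δ) (h0 : ∀ i ∈ T, 0 ≤ r i)
    (hsep : ∀ i ∈ T, ∀ j ∈ T, i ≠ j → δ ≤ |r i - r j|) :
    ∑ i ∈ T, Y / (1 + (Y * r i) ^ 2) ≤ Y + 2 / δ := by
  set q : ι → ℕ := fun i => ⌊r i / δ⌋₊ with hq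
  have hq1 (i) (hi : i ∈ T) : (q i : ℝ) * δ ≤ r i :=
    (le_div_iff₀ hδ).1 (Nat.floor_le (div_nonneg (h0 i hi) hδ.le))
  have hq2 (i) : r i < (q i + 1 : ℝ) * δ := (div_lt_iff₀ hδ).1 (Nat.lt_floor_add_one _)
  have hinj : Set.InjOn q T := by
    intro i hi j hj hij
    by_contra hne
    have h := hsep i hi j hj hne
    have a1 := hq1 i hi
    have a2 := hq2 i
    have a3 := hq1 j hj
    have a4 := hq2 j
    rw [hij] at a1 a2
    rcases abs_cases (r i - r j) with h' | h' <;> linarith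
  calc ∑ i ∈ T, Y / (1 + (Y * r i) ^ 2) ≤ ∑ i ∈ T, Y / (1 + (Y * (q i * δ)) ^ 2) := by
        refine Finset.sum_le_sum fun i hi => ?_
        have := hq1 i hi
        gcongr
    _ = ∑ k ∈ T.image q, Y / (1 + (Y * (k * δ)) ^ 2) :=
        (Finset.sum_image (f := fun k : ℕ => Y / (1 + (Y * (k * δ)) ^ 2)) hinj).symm
    _ ≤ ∑ k ∈ Finset.range ((T.image q).sup id + 1), Y / (1 + (Y * (k * δ)) ^ 2) := by
        refine Finset.sum_le_sum_of_subset_of_nonneg (fun k hk => ?_) fun k _ _ => by positivity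
        rw [Finset.mem_range, Nat.lt_succ_iff]
        exact Finset.le_sup (f := id) hk
    _ ≤ _ := sum_range_div_one_add_sq_le hY hδ _

theorem sum_div_one_add_sq_le {ι : Type*} (T : Finset ι) (r : ι → ℝ) {Y δ : ℝ} (hY : 0 < Y)
    (hδ : 0 < δ) (hsep : ∀ i ∈ T, ∀ j ∈ T, i ≠ j → δ ≤ |r i - r j|) :
    ∑ i ∈ T, Y / (1 + (Y * r i) ^ 2) ≤ 2 * (Y + 2 / δ) := by
  classical
  rw [← Finset.sum_filter_add_sum_filter_not T (fun i => 0 ≤ r i), two_mul]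
  refine add_le_add ?_ ?_
  · refine sum_div_one_add_sq_le_of_nonneg _ r hY hδ (fun i hi => (Finset.mem_filter.1 hi).2) ?_
    intro i hi j hj
    exact hsep i (Finset.mem_filter.1 hi).1 j (Finset.mem_filter.1 hj).1
  · have := sum_div_one_add_sq_le_of_nonneg (T.filter fun i => ¬ 0 ≤ r i) (fun i => - r i) hY hδ
      (fun i hi => by
        have := (Finset.mem_filter.1 hi).2
        linarith) (by
        intro i hi j hj hij
        have := hsep i (Finset.mem_filter.1 hi).1 j (Finset.mem_filter.1 hj).1 hij
        rw [abs_sub_comm] at this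
        rwa [show - r i - - r j = r j - r i by ring])
    simpa using this

/-- A large sieve inequality in `L¹`: at points that are `δ`-separated modulo `1`, the smoothed
exponential sums of length `Y` are controlled on average by the `L¹` norm of the sharp one. -/
theorem exists_sum_norm_sum_le_integral :
    ∃ C : ℝ, 0 < C ∧ ∀ (ι : Type) (T : Finset ι) (β : ι → ℝ) (X Y δ : ℝ), 0 < Y → Y < ⌊X⌋₊ + 1 →
      0 < δ → (∀ i ∈ T, ∀ j ∈ T, i ≠ j → ∀ k : ℤ, δ ≤ |β i - β j + k|) →
      ∑ i ∈ T, ‖∑ n ∈ Finset.Icc 1 ⌊X⌋₊,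
        ((ArithmeticFunction.liouville n : ℝ) * weight (n / Y) : ℂ) * addExp (n * β i)‖ ≤
      C * (Y + 2 / δ) * ∫ α in (0 : ℝ)..1, ‖liouvilleExpSum X α‖ := by
  obtain ⟨C, hC0, hC⟩ := exists_norm_kernel_le
  refine ⟨2 * C, by positivity, fun ι T β X Y δ hY hK hδ hsep => ?_⟩
  have hpt (α : ℝ) : ∑ i ∈ T, ‖kernel ⌊X⌋₊ Y (β i - α)‖ ≤ 2 * C * (Y + 2 / δ) := by
    -- The representative in `[-1/2, 1/2]` of `β i - α` modulo `1`.
    set r : ι → ℝ := fun i => β i - α - round (β i - α) with hr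
    have h1 (i) : ‖kernel ⌊X⌋₊ Y (β i - α)‖ ≤ C * (Y / (1 + (Y * r i) ^ 2)) := by
      have := hC ⌊X⌋₊ Y hY hK (r i) (abs_sub_round _)
      rw [← kernel_add_intCast _ _ _ (round (β i - α))] at this
      simpa [hr] using this
    refine (Finset.sum_le_sum fun i _ => h1 i).trans ?_
    rw [← Finset.mul_sum]
    have := sum_div_one_add_sq_le T r hY hδ fun i hi j hj hij => by
      have := hsep i hi j hj hij (round (β j - α) - round (β i - α))
      convert this using 2
      simp only [hr]; push_cast; ring
    calc _ ≤ C * (2 * (Y + 2 / δ)) := by gcongr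
      _ = _ := by ring
  have hkc (i : ι) : Continuous fun α => ‖liouvilleExpSum X α‖ * ‖kernel ⌊X⌋₊ Y (β i - α)‖ :=
    (continuous_liouvilleExpSum X).norm.mul
      ((continuous_kernel _ _).comp (continuous_const.sub continuous_id)).norm
  calc _ = ∑ i ∈ T, ‖∫ α in (0 : ℝ)..1, liouvilleExpSum X α * kernel ⌊X⌋₊ Y (β i - α)‖ := by
        simp only [integral_liouvilleExpSum_mul_kernel]
    _ ≤ ∑ i ∈ T, ∫ α in (0 : ℝ)..1, ‖liouvilleExpSum X α‖ * ‖kernel ⌊X⌋₊ Y (β i - α)‖ := by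
        refine Finset.sum_le_sum fun i _ => ?_
        refine (intervalIntegral.norm_integral_le_integral_norm zero_le_one).trans_eq ?_
        simp only [norm_mul]
    _ = ∫ α in (0 : ℝ)..1, ∑ i ∈ T, ‖liouvilleExpSum X α‖ * ‖kernel ⌊X⌋₊ Y (β i - α)‖ :=
        (intervalIntegral.integral_finsetSum fun i _ => (hkc i).intervalIntegrable _ _).symm
    _ ≤ ∫ α in (0 : ℝ)..1, 2 * C * (Y + 2 / δ) * ‖liouvilleExpSum X α‖ := by
        refine intervalIntegral.integral_mono_on zero_le_one
          ((continuous_finsetSum _ fun i _ => hkc i).intervalIntegrable _ _)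
          ((continuous_const.mul (continuous_liouvilleExpSum X).norm).intervalIntegrable _ _)
          fun α _ => ?_
        rw [← Finset.mul_sum, mul_comm]
        exact mul_le_mul_of_nonneg_right (hpt α) (norm_nonneg _)
    _ = _ := by rw [intervalIntegral.integral_const_mul]

/-! ### Fractions with prime denominators -/

theorem sum_Icc_addExp_mul_div {p : ℕ} (hp : p.Prime) (n : ℕ) :
    ∑ a ∈ Finset.Icc 1 (p - 1), addExp (n * (a / p)) = (if p ∣ n then (p : ℂ) else 0) - 1 := by
  have hp0 : (p : ℝ) ≠ 0 := by exact_mod_cast hp.ne_zero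
  have e (a : ℕ) : addExp (n * (a / p)) = addExp (n / p) ^ a := by
    rw [← addExp_natCast_mul]; congr 1; ring
  have h1 : ∑ a ∈ Finset.range p, addExp (n / p) ^ a =
      ∑ a ∈ Finset.Icc 1 (p - 1), addExp (n * (a / p)) + 1 := by
    have : Finset.Icc 1 (p - 1) = Finset.Ico 1 p := by
      ext a; simp only [Finset.mem_Icc, Finset.mem_Ico]; have := hp.pos; omega
    rw [this, Finset.range_eq_Ico, Finset.sum_eq_sum_Ico_succ_bot hp.pos, pow_zero, add_comm]
    simp only [e]
  rw [eq_sub_iff_add_eq, ← h1]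
  have hz : addExp (n / p) = 1 ↔ p ∣ n := by
    rw [addExp_eq_one_iff]
    constructor
    · rintro ⟨k, hk⟩
      rw [div_eq_iff hp0] at hk
      have : (n : ℤ) = k * p := by exact_mod_cast hk
      exact Int.natCast_dvd_natCast.1 ⟨k, by rw [this]; ring⟩
    · rintro ⟨k, rfl⟩
      exact ⟨k, by push_cast; field_simp⟩
  split_ifs with h
  · rw [hz.2 h]; simp
  · have hne : addExp (n / p) ≠ 1 := fun h' => h (hz.1 h')
    rw [geom_sum_eq hne, ← addExp_natCast_mul, mul_div_cancel₀ _ hp0,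
      addExp_eq_one_iff.2 ⟨n, by simp⟩]
    simp

theorem sum_dvd_liouville_mul_weight {p K : ℕ} (hp : p.Prime) {Y : ℝ} (hY : 0 < Y) (hK : Y < K + 1) :
    ∑ n ∈ Finset.Icc 1 K with p ∣ n, (ArithmeticFunction.liouville n : ℝ) * weight (n / Y) =
      -smoothSum K (Y / p) := by
  have hp0 : (0 : ℝ) < p := by exact_mod_cast hp.pos
  have hlp : ArithmeticFunction.liouville p = -1 := by
    rw [ArithmeticFunction.liouville_apply hp.ne_zero, ArithmeticFunction.cardFactors_apply_prime hp,
      pow_one]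
  unfold smoothSum
  rw [← Finset.sum_neg_distrib, ← Finset.sum_filter_of_ne (s := Finset.Icc 1 K) (p := fun m => p * m ≤ K)]
  · refine (Finset.sum_bij' (fun m _ => p * m) (fun n _ => n / p) ?_ ?_ ?_ ?_ ?_).symm
    · intro m hm
      simp only [Finset.mem_filter, Finset.mem_Icc] at hm ⊢
      exact ⟨⟨Nat.mul_pos hp.pos hm.1.1, hm.2⟩, dvd_mul_right _ _⟩
    · intro n hn
      simp only [Finset.mem_filter, Finset.mem_Icc] at hn ⊢
      refine ⟨⟨Nat.div_pos (Nat.le_of_dvd hn.1.1 hn.2) hp.pos, (Nat.div_le_self _ _).trans hn.1.2⟩, ?_⟩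
      rw [Nat.mul_div_cancel' hn.2]; exact hn.1.2
    · intro m _
      exact Nat.mul_div_cancel_left _ hp.pos
    · intro n hn
      exact Nat.mul_div_cancel' (Finset.mem_filter.1 hn).2
    · intro m _
      rw [ArithmeticFunction.liouville_apply_mul, hlp]
      have : ((p * m : ℕ) : ℝ) / Y = m / (Y / p) := by push_cast; field_simp
      rw [this]; push_cast; ring
  · intro m _ h
    by_contra h'
    apply h
    rw [weight_of_one_le]; · simp
    rw [one_le_div (by positivity), div_le_iff₀ hp0]
    have : (K : ℝ) + 1 ≤ p * m := by exact_mod_cast not_le.1 h'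
    linarith

/-- Averaging the smoothed exponential sum over all `a / p` with `0 < a < p` singles out the
multiples of `p`, and `λ(p n) = -λ(n)`. -/
theorem sum_sum_liouville_mul_weight_mul_addExp {p K : ℕ} (hp : p.Prime) {Y : ℝ} (hY : 0 < Y)
    (hK : Y < K + 1) :
    ∑ a ∈ Finset.Icc 1 (p - 1), ∑ n ∈ Finset.Icc 1 K,
      ((ArithmeticFunction.liouville n : ℝ) * weight (n / Y) : ℂ) * addExp (n * (a / p)) =
      -((smoothSum K Y + p * smoothSum K (Y / p) : ℝ) : ℂ) := by
  rw [Finset.sum_comm]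
  simp only [← Finset.mul_sum, sum_Icc_addExp_mul_div hp, mul_sub, mul_one, mul_ite, mul_zero]
  rw [Finset.sum_sub_distrib, ← Finset.sum_filter, ← Finset.sum_mul]
  have h := congrArg (Complex.ofReal) (sum_dvd_liouville_mul_weight hp hY hK)
  push_cast at h ⊢
  rw [h]
  simp only [smoothSum]
  push_cast
  ring

/-- Fractions `a / p` with prime denominators `p ≤ √X` are `1 / X`-separated modulo `1`, so the
`L¹` large sieve applies to all of them at once. -/
theorem exists_sum_prime_abs_smoothSum_le :
    ∃ C : ℝ, 0 < C ∧ ∀ (X Y : ℝ) (s : Finset ℕ), 1 ≤ X → 0 < Y → Y ≤ X →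
      (∀ p ∈ s, p.Prime ∧ (p : ℝ) ^ 2 ≤ X) →
      ∑ p ∈ s, |smoothSum ⌊X⌋₊ Y + p * smoothSum ⌊X⌋₊ (Y / p)| ≤
        C * X * ∫ α in (0 : ℝ)..1, ‖liouvilleExpSum X α‖ := by
  obtain ⟨C, hC0, hC⟩ := exists_sum_norm_sum_le_integral
  refine ⟨3 * C, by positivity, fun X Y s hX hY hYX hs => ?_⟩
  have hK : Y < ⌊X⌋₊ + 1 := hYX.trans_lt (Nat.lt_floor_add_one X)
  have hX0 : 0 < X := by linarith
  have h := hC (Σ _ : ℕ, ℕ) (s.sigma fun p => Finset.Icc 1 (p - 1)) (fun i => (i.2 : ℝ) / i.1) X Y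
    (1 / X) hY hK (by positivity) (by
      rintro ⟨p, a⟩ hi ⟨p', a'⟩ hj hij k
      simp only [Finset.mem_sigma, Finset.mem_Icc] at hi hj ⊢
      obtain ⟨hp, ha1, ha2⟩ := hi
      obtain ⟨hp', ha1', ha2'⟩ := hj
      obtain ⟨hpp, hpX⟩ := hs p hp
      obtain ⟨hpp', hpX'⟩ := hs p' hp'
      have p0 : (0 : ℝ) < p := by exact_mod_cast hpp.pos
      have p0' : (0 : ℝ) < p' := by exact_mod_cast hpp'.pos
      have e : (a : ℝ) / p - a' / p' + k = ((a * p' - a' * p + k * p * p' : ℤ) : ℝ) / (p * p') := by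
        push_cast; field_simp
      have hne : (a * p' - a' * p + k * p * p' : ℤ) ≠ 0 := by
        intro h0
        have hd : p ∣ p' := by
          have h1 : (p : ℤ) ∣ (a : ℤ) * p' := ⟨a' - k * p', by linear_combination h0⟩
          have h2 : p ∣ a * p' := by exact_mod_cast h1
          rcases hpp.dvd_mul.1 h2 with h3 | h3
          · have := Nat.le_of_dvd ha1 h3
            have := hpp.pos
            omega
          · exact h3
        obtain rfl : p = p' := (Nat.prime_dvd_prime_iff_eq hpp hpp').1 hd
        have hpz : (p : ℤ) ≠ 0 := by exact_mod_cast hpp.ne_zero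
        have h3 : (a : ℤ) - a' + k * p = 0 := by
          apply mul_left_cancel₀ hpz
          linear_combination h0
        have hk : k = 0 := by
          have := hpp.pos
          by_contra hk0
          rcases lt_or_gt_of_ne hk0 with h4 | h4
          · have : k * p ≤ -1 * p := by
              apply mul_le_mul_of_nonneg_right (by omega) (by omega)
            omega
          · have : 1 * (p : ℤ) ≤ k * p := by
              apply mul_le_mul_of_nonneg_right (by omega) (by omega)
            omega
        subst hk
        apply hij
        have : a = a' := by omega
        rw [this]
      have h1 : (1 : ℝ) ≤ |((a * p' - a' * p + k * p * p' : ℤ) : ℝ)| := by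
        exact_mod_cast Int.one_le_abs hne
      rw [e, abs_div, abs_of_pos (mul_pos p0 p0')]
      have h2 : (p : ℝ) * p' ≤ X := by nlinarith [sq_nonneg ((p : ℝ) - p')]
      exact div_le_div₀ (abs_nonneg _) h1 (mul_pos p0 p0') h2)
  rw [Finset.sum_sigma] at h
  calc _ ≤ ∑ p ∈ s, ∑ a ∈ Finset.Icc 1 (p - 1), ‖∑ n ∈ Finset.Icc 1 ⌊X⌋₊,
        ((ArithmeticFunction.liouville n : ℝ) * weight (n / Y) : ℂ) * addExp (n * (a / p))‖ := by
        refine Finset.sum_le_sum fun p hp => ?_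
        refine le_trans (le_of_eq ?_) (norm_sum_le _ _)
        rw [sum_sum_liouville_mul_weight_mul_addExp (hs p hp).1 hY hK, norm_neg, Complex.norm_real,
          Real.norm_eq_abs]
    _ ≤ _ := h
    _ ≤ _ := by
        refine mul_le_mul_of_nonneg_right ?_
          (intervalIntegral.integral_nonneg zero_le_one fun _ _ => norm_nonneg _)
        rw [div_div_eq_mul_div, div_one]
        nlinarith

/-! ### Sums over primes -/

theorem exists_rpow_le_primeCounting {η : ℝ} (hη : 0 < η) :
    ∃ c : ℝ, 0 < c ∧ ∃ n₀ : ℕ, ∀ n : ℕ, n₀ ≤ n → c * (n : ℝ) ^ (1 - η) ≤ Nat.primeCounting n := by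
  have hlog : ∀ᶠ x : ℝ in Filter.atTop, Real.log x ≤ 1 / 8 * x := by
    have := Real.isLittleO_log_id_atTop.def (c := 1 / 8) (by norm_num)
    filter_upwards [this, Filter.eventually_ge_atTop 1] with x hx h1
    rw [Real.norm_eq_abs, Real.norm_eq_abs, id, abs_of_pos (by linarith : (0:ℝ) < x)] at hx
    exact (le_abs_self _).trans hx
  obtain ⟨x₀, hx₀⟩ := Filter.eventually_atTop.1 hlog
  refine ⟨η / 4, by positivity, max 2 ⌈x₀⌉₊, fun n hn => ?_⟩
  have hn2 : 2 ≤ n := (le_max_left _ _).trans hn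
  have hn0 : x₀ ≤ n := (Nat.le_ceil x₀).trans (by exact_mod_cast (le_max_right _ _).trans hn)
  have hn2' : (2 : ℝ) ≤ n := by exact_mod_cast hn2
  have hnp : (0 : ℝ) < n := by linarith
  have h1 := hx₀ (n + 1) (by linarith)
  have h2 : (n : ℝ) * Real.log 2 - Real.log (n + 1) ≤ Nat.primeCounting n * Real.log n := by
    have := Chebyshev.pi_ge n
    rwa [div_le_iff₀ (Real.log_pos (by linarith))] at this
  have h3 := Real.log_le_rpow_div hnp.le hη
  have h4 : (n : ℝ) / 4 ≤ Nat.primeCounting n * ((n : ℝ) ^ η / η) := by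
    calc (n : ℝ) / 4 ≤ n * Real.log 2 - Real.log (n + 1) := by
          nlinarith [Real.log_two_gt_d9]
      _ ≤ _ := h2
      _ ≤ _ := by gcongr
  rw [Real.rpow_sub hnp, Real.rpow_one, mul_div_assoc', div_le_iff₀ (by positivity)]
  rw [mul_div_assoc', le_div_iff₀ hη] at h4
  linarith

/-- Of the `π(n)` primes up to `n`, at least half exceed `π(n) / 2`. -/
theorem half_mul_sqrt_half_le_sum_sqrt_prime (n : ℕ) :
    (Nat.primeCounting n : ℝ) / 2 * √((Nat.primeCounting n : ℝ) / 2) ≤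
      ∑ p ∈ Finset.Icc 1 n with p.Prime, √(p : ℝ) := by
  set k := Nat.primeCounting n with hk
  set s := (Finset.Icc 1 n).filter Nat.Prime with hs
  have hcard : s.card = k := by
    rw [hk, Nat.primeCounting, Nat.primeCounting', Nat.count_eq_card_filter_range]
    congr 1
    ext p
    simp only [hs, Finset.mem_filter, Finset.mem_Icc, Finset.mem_range]
    constructor
    · rintro ⟨h1, h2⟩; exact ⟨by omega, h2⟩
    · rintro ⟨h1, h2⟩; exact ⟨⟨h2.pos, by omega⟩, h2⟩
  have h1 : (s.filter fun p => 2 * p ≤ k).card ≤ k / 2 := by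
    have : (s.filter fun p => 2 * p ≤ k) ⊆ Finset.Icc 1 (k / 2) := by
      intro p hp
      simp only [hs, Finset.mem_filter, Finset.mem_Icc] at hp ⊢
      omega
    simpa using Finset.card_le_card this
  have h2 := Finset.card_filter_add_card_filter_not (s := s) fun p => 2 * p ≤ k
  have h3 : k ≤ 2 * (s.filter fun p => ¬ 2 * p ≤ k).card := by omega
  have h4 : (k : ℝ) / 2 ≤ (s.filter fun p => ¬ 2 * p ≤ k).card := by
    have : (k : ℝ) ≤ 2 * (s.filter fun p => ¬ 2 * p ≤ k).card := by exact_mod_cast h3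
    linarith
  calc (k : ℝ) / 2 * √((k : ℝ) / 2) ≤ (s.filter fun p => ¬ 2 * p ≤ k).card * √((k : ℝ) / 2) := by
        gcongr
    _ ≤ ∑ p ∈ s with ¬ 2 * p ≤ k, √(p : ℝ) := by
        rw [← nsmul_eq_mul]
        refine Finset.card_nsmul_le_sum _ _ _ fun p hp => ?_
        apply Real.sqrt_le_sqrt
        have := (Finset.mem_filter.1 hp).2
        have : (k : ℝ) < 2 * p := by exact_mod_cast not_le.1 this
        linarith
    _ ≤ _ := Finset.sum_le_sum_of_subset_of_nonneg (Finset.filter_subset _ _)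
        fun _ _ _ => Real.sqrt_nonneg _

theorem exists_rpow_le_sum_sqrt_prime {η : ℝ} (hη : 0 < η) (hη1 : η < 1) :
    ∃ c : ℝ, 0 < c ∧ ∃ P₀ : ℝ, ∀ P : ℝ, P₀ ≤ P →
      c * P ^ (3 / 2 * (1 - η)) ≤ ∑ p ∈ Finset.Icc 1 ⌊P⌋₊ with p.Prime, √(p : ℝ) := by
  obtain ⟨c, hc, n₀, hn₀⟩ := exists_rpow_le_primeCounting hη
  refine ⟨(c / 4) ^ (3 / 2 : ℝ), by positivity, n₀ + 1, fun P hP => ?_⟩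
  have hn0 : (0 : ℝ) ≤ n₀ := Nat.cast_nonneg _
  have hP1 : 1 ≤ P := by linarith
  have hP0 : 0 < P := by linarith
  set n := ⌊P⌋₊ with hn
  have hnP : P / 2 ≤ n := by
    have h1 := Nat.lt_floor_add_one P
    have h2 : (1 : ℝ) ≤ ⌊P⌋₊ := by exact_mod_cast Nat.le_floor (by simpa using hP1)
    linarith
  have h1 := hn₀ n (Nat.le_floor (by linarith))
  -- The factor `4` pays for halving `π(n)` and for `n = ⌊P⌋ ≥ P / 2`.
  have h2 : c / 4 * P ^ (1 - η) ≤ (Nat.primeCounting n : ℝ) / 2 := by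
    have h3 : (P / 2) ^ (1 - η) ≤ (n : ℝ) ^ (1 - η) :=
      Real.rpow_le_rpow (by positivity) hnP (by linarith)
    rw [Real.div_rpow hP0.le (by norm_num)] at h3
    have h4 : (2 : ℝ) ^ (1 - η) ≤ 2 := by
      calc (2 : ℝ) ^ (1 - η) ≤ 2 ^ (1 : ℝ) := Real.rpow_le_rpow_of_exponent_le (by norm_num) (by linarith)
        _ = 2 := Real.rpow_one _
    have h5 : P ^ (1 - η) / 2 ≤ P ^ (1 - η) / 2 ^ (1 - η) := by gcongr
    have h6 : c * (P ^ (1 - η) / 2) ≤ c * (n : ℝ) ^ (1 - η) := by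
      apply mul_le_mul_of_nonneg_left _ hc.le
      linarith
    linarith
  refine le_trans ?_ (half_mul_sqrt_half_le_sum_sqrt_prime n)
  set u := c / 4 * P ^ (1 - η) with hu
  have hu0 : 0 < u := by positivity
  calc (c / 4) ^ (3 / 2 : ℝ) * P ^ (3 / 2 * (1 - η)) = u ^ (3 / 2 : ℝ) := by
        rw [hu, Real.mul_rpow (by positivity) (by positivity), ← Real.rpow_mul hP0.le]
        ring_nf
    _ = u * √u := by
        rw [Real.sqrt_eq_rpow, show (3 / 2 : ℝ) = 1 + 1 / 2 by norm_num, Real.rpow_add hu0,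
          Real.rpow_one]
    _ ≤ _ := by gcongr

/-! ### The lower bound -/

/-- The alternating sums of `M(X / m)` and of `p M(X / (p m))`, with `M` the smoothed sum, have main
terms of the same sign, `√X` and `√(p X)` times a positive constant. The error `O(p)` is smaller than
`√(p X)` because `p ≤ √X`. -/
theorem exists_mul_sqrt_mul_sqrt_le_sum {η : ℝ} (hη : 0 < η) :
    ∃ c : ℝ, 0 < c ∧ ∃ X₀ : ℝ, ∀ X : ℝ, X₀ ≤ X → ∀ p : ℕ, p.Prime → (p : ℝ) ≤ √X →
      c * (√X * √p) ≤ ∑ m ∈ Finset.Icc 1 ⌊X⌋₊, cutoff (m / X ^ η) *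
        |smoothSum ⌊X⌋₊ (X / m) + p * smoothSum ⌊X⌋₊ (X / m / p)| := by
  set A : ℕ := ⌈2 / η⌉₊ with hA
  obtain ⟨C, hC0, hC⟩ := exists_abs_sum_cutoff_smoothSum_sub_le A
  set D : ℝ := C * (2 + A) with hD
  have hD0 : 0 < D := by positivity
  set κ : ℝ := squareDensity * (√2 - 1) with hκ
  have hκ0 : 0 < κ := by
    have : (1 : ℝ) < √2 := by rw [Real.lt_sqrt] <;> norm_num
    exact mul_pos squareDensity_pos (by linarith)
  -- The fourth power ensures `4 * D ≤ κ * X ^ (1 / 4)`, so that `D * (1 + p)` is at most half of the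
  -- main term of the `p`-part.
  refine ⟨κ / 2, by positivity, max 4 ((4 * D / κ) ^ 4), fun X hX p hp hpX => ?_⟩
  have hX4 : 4 ≤ X := (le_max_left _ _).trans hX
  have hX0 : 0 < X := by linarith
  set K := ⌊X⌋₊ with hK
  have hKX : (K : ℝ) ≤ X := Nat.floor_le hX0.le
  have hXK : X < K + 1 := Nat.lt_floor_add_one X
  have hN : 0 < X ^ η := by positivity
  have hp1 : (1 : ℝ) ≤ p := by exact_mod_cast hp.pos
  have hp0 : (0 : ℝ) < p := by linarith
  -- `A` is large enough for the truncation error to be bounded.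
  have hNA : X ^ 2 ≤ (X ^ η) ^ A := by
    rw [← Real.rpow_natCast (X ^ η), ← Real.rpow_mul hX0.le, ← Real.rpow_natCast X 2]
    apply Real.rpow_le_rpow_of_exponent_le (by linarith)
    have := Nat.le_ceil (2 / η)
    rw [div_le_iff₀ hη] at this
    push_cast
    rw [mul_comm]; exact this
  have herr (Y : ℝ) (hY2 : 2 ≤ Y) (hYX : Y ≤ X) :
      |∑ m ∈ Finset.Icc 1 K, (-1 : ℝ) ^ m * cutoff (m / X ^ η) * smoothSum K (Y / m) - κ * √Y| ≤ D := by
    refine (hC Y (X ^ η) K hY2 hN (by linarith)).trans ?_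
    have h1 : (K : ℝ) * (Y + A) / (X ^ η) ^ A ≤ 1 + A := by
      rw [div_le_iff₀ (by positivity)]
      have hA0 : (0 : ℝ) ≤ A := Nat.cast_nonneg _
      calc (K : ℝ) * (Y + A) ≤ X * (X + A * X) := by
            apply mul_le_mul hKX _ (by positivity) hX0.le
            nlinarith
        _ = (1 + A) * X ^ 2 := by ring
        _ ≤ (1 + A) * (X ^ η) ^ A := by gcongr
    rw [hD]
    apply mul_le_mul_of_nonneg_left _ hC0.le
    linarith
  set x := √X with hx
  have hxX : x ^ 2 = X := Real.sq_sqrt hX0.le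
  have hx2 : 2 ≤ x := Real.le_sqrt_of_sq_le (by linarith)
  set y := √x with hy
  have hyx : y ^ 2 = x := Real.sq_sqrt (by linarith)
  have hy0 : 0 < y := Real.sqrt_pos.2 (by linarith)
  set q := √(p : ℝ) with hq
  have hqp : q ^ 2 = p := Real.sq_sqrt hp0.le
  have hq0 : 0 < q := Real.sqrt_pos.2 hp0
  have hqy : q ≤ y := Real.sqrt_le_sqrt hpX
  have hyD : 4 * D ≤ κ * y := by
    have h1 : (4 * D / κ) ^ 4 ≤ y ^ 4 := by
      rw [show y ^ 4 = (y ^ 2) ^ 2 by ring, hyx, hxX]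
      exact (le_max_right _ _).trans hX
    have := le_of_pow_le_pow_left₀ (by norm_num) hy0.le h1
    rwa [div_le_iff₀ hκ0, mul_comm y] at this
  have hXp : 2 ≤ X / p := by
    rw [le_div_iff₀ hp0, ← hxX]; nlinarith
  have h1 := herr X (by linarith) le_rfl
  have h2 := herr (X / p) hXp (div_le_self hX0.le hp1)
  have hsq : √(X / p) = x / q := Real.sqrt_div' _ hp0.le
  rw [hsq] at h2
  have e : ∑ m ∈ Finset.Icc 1 K, (-1 : ℝ) ^ m * cutoff (m / X ^ η) *
      (smoothSum K (X / m) + p * smoothSum K (X / m / p)) =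
      ∑ m ∈ Finset.Icc 1 K, (-1 : ℝ) ^ m * cutoff (m / X ^ η) * smoothSum K (X / m) +
      p * ∑ m ∈ Finset.Icc 1 K, (-1 : ℝ) ^ m * cutoff (m / X ^ η) * smoothSum K (X / p / m) := by
    rw [Finset.mul_sum, ← Finset.sum_add_distrib]
    refine Finset.sum_congr rfl fun m _ => ?_
    rw [div_right_comm X]; ring
  have h3 : ∑ m ∈ Finset.Icc 1 K, (-1 : ℝ) ^ m * cutoff (m / X ^ η) *
      (smoothSum K (X / m) + p * smoothSum K (X / m / p)) ≤
      ∑ m ∈ Finset.Icc 1 K, cutoff (m / X ^ η) *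
        |smoothSum K (X / m) + p * smoothSum K (X / m / p)| := by
    refine Finset.sum_le_sum fun m _ => (le_abs_self _).trans_eq ?_
    rw [abs_mul, abs_mul, abs_pow, abs_neg, abs_one, one_pow, one_mul, abs_of_nonneg cutoff.nonneg]
  refine le_trans ?_ h3
  rw [e]
  have h4 := (abs_le.1 h1).1
  have h5 := mul_le_mul_of_nonneg_left (abs_le.1 h2).1 hp0.le
  have h6 : p * (κ * (x / q)) = κ * (x * q) := by
    rw [← hqp]; field_simp
  rw [mul_sub, h6] at h5
  have h7 : D * (1 + p) ≤ κ / 2 * (x * q) := by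
    have a1 : D * (1 + p) ≤ 2 * D * q ^ 2 := by rw [hqp]; nlinarith
    have a2 : 2 * D * q ^ 2 ≤ 2 * D * (q * y) := by
      rw [pow_two]; gcongr
    have a3 : 2 * D * (q * y) ≤ κ / 2 * y * (q * y) := by
      apply mul_le_mul_of_nonneg_right _ (by positivity)
      linarith
    have a4 : κ / 2 * y * (q * y) = κ / 2 * (x * q) := by rw [← hyx]; ring
    linarith
  have h8 : 0 ≤ κ * x := by positivity
  linarith

/-- The `L¹` norm is at least the Fourier coefficient `λ(1)`. -/
theorem one_le_integral_norm_liouvilleExpSum {X : ℝ} (hX : 1 ≤ X) :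
    1 ≤ ∫ α in (0 : ℝ)..1, ‖liouvilleExpSum X α‖ := by
  have h1 : ∫ α in (0 : ℝ)..1, liouvilleExpSum X α * addExp (-α) = 1 := by
    simp only [liouvilleExpSum, Finset.sum_mul]
    rw [intervalIntegral.integral_finsetSum fun n _ => by
      apply Continuous.intervalIntegrable
      exact (continuous_const.mul (continuous_addExp.comp (by fun_prop))).mul
        (continuous_addExp.comp (by fun_prop))]
    have h (n : ℕ) : ∫ α in (0 : ℝ)..1, (ArithmeticFunction.liouville n : ℂ) *
        addExp ((n : ℝ) * α) * addExp (-α) = if n = 1 then 1 else 0 := by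
      have e (α : ℝ) : (ArithmeticFunction.liouville n : ℂ) * addExp ((n : ℝ) * α) * addExp (-α) =
          (ArithmeticFunction.liouville n : ℂ) * addExp (((n - 1 : ℤ) : ℝ) * α) := by
        rw [mul_assoc, ← addExp_add]; push_cast; ring_nf
      simp only [e]
      rw [intervalIntegral.integral_const_mul, integral_addExp_intCast_mul]
      by_cases hn : n = 1
      · subst hn; simp [ArithmeticFunction.liouville_apply_one]
      · rw [if_neg (by omega), if_neg hn, mul_zero]
    simp only [h]
    rw [Finset.sum_ite_eq', if_pos]
    exact Finset.mem_Icc.2 ⟨le_rfl, Nat.le_floor (by simpa using hX)⟩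
  have h2 := intervalIntegral.norm_integral_le_integral_norm (μ := MeasureTheory.volume)
    (f := fun α => liouvilleExpSum X α * addExp (-α)) (zero_le_one (α := ℝ))
  rw [h1] at h2
  simpa [norm_addExp] using h2

theorem exists_rpow_le_integral_of_ge {η : ℝ} (hη : 0 < η) (hη1 : η < 1) :
    ∃ c : ℝ, 0 < c ∧ ∃ X₀ : ℝ, ∀ X : ℝ, X₀ ≤ X →
      c * X ^ (1 / 4 - 7 / 4 * η) ≤ ∫ α in (0 : ℝ)..1, ‖liouvilleExpSum X α‖ := by
  obtain ⟨c₁, hc₁, X₁, h₁⟩ := exists_mul_sqrt_mul_sqrt_le_sum hη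
  obtain ⟨c₂, hc₂, P₀, h₂⟩ := exists_rpow_le_sum_sqrt_prime hη hη1
  obtain ⟨C, hC0, hC⟩ := exists_sum_prime_abs_smoothSum_le
  refine ⟨c₁ * c₂ / (2 * C), by positivity, max 1 (max X₁ (P₀ ^ 2)), fun X hX => ?_⟩
  have hX1 : 1 ≤ X := (le_max_left _ _).trans hX
  have hX0 : 0 < X := by linarith
  have hXX₁ : X₁ ≤ X := (le_max_left _ _).trans ((le_max_right _ _).trans hX)
  have hXP : P₀ ≤ √X := Real.le_sqrt_of_sq_le ((le_max_right _ _).trans ((le_max_right _ _).trans hX))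
  set I := ∫ α in (0 : ℝ)..1, ‖liouvilleExpSum X α‖ with hI
  have hI0 : 0 ≤ I := intervalIntegral.integral_nonneg zero_le_one fun _ _ => norm_nonneg _
  set s := (Finset.Icc 1 ⌊√X⌋₊).filter Nat.Prime with hs
  have hsp : ∀ p ∈ s, p.Prime ∧ (p : ℝ) ≤ √X := by
    intro p hp
    simp only [hs, Finset.mem_filter, Finset.mem_Icc] at hp
    exact ⟨hp.2, (Nat.le_floor_iff (Real.sqrt_nonneg _)).1 hp.1.2⟩
  have hN : 0 < X ^ η := by positivity
  have lower : c₁ * √X * ∑ p ∈ s, √(p : ℝ) ≤ ∑ p ∈ s, ∑ m ∈ Finset.Icc 1 ⌊X⌋₊, cutoff (m / X ^ η) *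
        |smoothSum ⌊X⌋₊ (X / m) + p * smoothSum ⌊X⌋₊ (X / m / p)| := by
    rw [Finset.mul_sum]
    refine Finset.sum_le_sum fun p hp => ?_
    rw [mul_assoc]
    exact h₁ X hXX₁ p (hsp p hp).1 (hsp p hp).2
  have upper : ∑ p ∈ s, ∑ m ∈ Finset.Icc 1 ⌊X⌋₊, cutoff (m / X ^ η) *
        |smoothSum ⌊X⌋₊ (X / m) + p * smoothSum ⌊X⌋₊ (X / m / p)| ≤ 2 * X ^ η * (C * X * I) := by
    rw [Finset.sum_comm]
    simp only [← Finset.mul_sum]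
    have hb (m : ℕ) (hm : 1 ≤ m) : ∑ p ∈ s, |smoothSum ⌊X⌋₊ (X / m) + p * smoothSum ⌊X⌋₊ (X / m / p)| ≤
        C * X * I := by
      have hm' : (1 : ℝ) ≤ m := by exact_mod_cast hm
      refine hC X (X / m) s hX1 (by positivity) (div_le_self hX0.le hm') fun p hp => ⟨(hsp p hp).1, ?_⟩
      calc (p : ℝ) ^ 2 ≤ √X ^ 2 := by
            have := (hsp p hp).2
            gcongr
        _ = X := Real.sq_sqrt hX0.le
    have hsub : ∑ m ∈ Finset.Icc 1 ⌊X⌋₊, cutoff (m / X ^ η) *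
        ∑ p ∈ s, |smoothSum ⌊X⌋₊ (X / m) + p * smoothSum ⌊X⌋₊ (X / m / p)| =
        ∑ m ∈ Finset.Icc 1 ⌊X⌋₊ with m ≤ ⌊2 * X ^ η⌋₊, cutoff (m / X ^ η) *
        ∑ p ∈ s, |smoothSum ⌊X⌋₊ (X / m) + p * smoothSum ⌊X⌋₊ (X / m / p)| := by
      symm
      apply Finset.sum_filter_of_ne
      intro m _ h
      by_contra h'
      apply h
      rw [cutoff_of_two_le, zero_mul]
      rw [le_div_iff₀ hN]
      exact (Nat.lt_of_floor_lt (not_le.1 h')).le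
    rw [hsub]
    have hB : 0 ≤ C * X * I := by positivity
    refine (Finset.sum_le_card_nsmul _ _ (C * X * I) fun m hm => ?_).trans ?_
    · simp only [Finset.mem_filter, Finset.mem_Icc] at hm
      calc _ ≤ 1 * (C * X * I) := mul_le_mul cutoff.le_one (hb m hm.1.1)
            (Finset.sum_nonneg fun _ _ => abs_nonneg _) zero_le_one
        _ = _ := one_mul _
    · rw [nsmul_eq_mul]
      refine mul_le_mul_of_nonneg_right ?_ hB
      have : ((Finset.Icc 1 ⌊X⌋₊).filter (· ≤ ⌊2 * X ^ η⌋₊)).card ≤ ⌊2 * X ^ η⌋₊ := by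
        have : (Finset.Icc 1 ⌊X⌋₊).filter (· ≤ ⌊2 * X ^ η⌋₊) ⊆ Finset.Icc 1 ⌊2 * X ^ η⌋₊ := by
          intro m hm
          simp only [Finset.mem_filter, Finset.mem_Icc] at hm ⊢
          exact ⟨hm.1.1, hm.2⟩
        simpa using Finset.card_le_card this
      exact (Nat.cast_le.2 this).trans (Nat.floor_le (by positivity))
  have h3 := h₂ √X hXP
  have h4 : c₁ * √X * (c₂ * √X ^ (3 / 2 * (1 - η))) ≤ 2 * X ^ η * (C * X * I) :=
    (mul_le_mul_of_nonneg_left h3 (by positivity)).trans (lower.trans upper)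
  have h5 : √X * √X ^ (3 / 2 * (1 - η)) = X ^ (1 / 4 - 7 / 4 * η) * (X ^ η * X) := by
    have e1 : X ^ η * X = X ^ (η + 1) := by rw [Real.rpow_add hX0, Real.rpow_one]
    rw [e1, ← Real.rpow_add hX0, Real.sqrt_eq_rpow, ← Real.rpow_mul hX0.le, ← Real.rpow_add hX0]
    ring_nf
  have hpos : 0 < X ^ η * X := by positivity
  rw [div_mul_eq_mul_div, div_le_iff₀ (by positivity)]
  refine le_of_mul_le_mul_right ?_ hpos
  calc c₁ * c₂ * X ^ (1 / 4 - 7 / 4 * η) * (X ^ η * X)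
      = c₁ * √X * (c₂ * √X ^ (3 / 2 * (1 - η))) := by
        linear_combination (-(c₁ * c₂)) * h5
    _ ≤ 2 * X ^ η * (C * X * I) := h4
    _ = I * (2 * C) * (X ^ η * X) := by ring

theorem theorem1 (ε : ℝ) (hε : 0 < ε) :
    ∃ c : ℝ, 0 < c ∧ ∀ X : ℝ, 1 ≤ X →
      c * X ^ ((1 : ℝ) / 4 - ε) ≤ ∫ α in (0 : ℝ)..1, ‖liouvilleExpSum X α‖ := by
  set η : ℝ := min (ε / 2) (1 / 2) with hη
  have hη0 : 0 < η := lt_min (by linarith) (by norm_num)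
  have hηε : η ≤ ε / 2 := min_le_left _ _
  have hη1 : η < 1 := (min_le_right _ _).trans_lt (by norm_num)
  obtain ⟨c, hc, X₀, h⟩ := exists_rpow_le_integral_of_ge hη0 hη1
  have hM : 0 < max 1 X₀ := lt_max_of_lt_left one_pos
  refine ⟨min c (1 / max 1 X₀), lt_min hc (by positivity), fun X hX => ?_⟩
  have hX0 : 0 < X := by linarith
  rcases le_or_gt X₀ X with hXX | hXX
  · refine le_trans ?_ (h X hXX)
    exact mul_le_mul (min_le_left _ _) (Real.rpow_le_rpow_of_exponent_le hX (by linarith))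
      (by positivity) hc.le
  · refine le_trans ?_ (one_le_integral_norm_liouvilleExpSum hX)
    have h1 : X ^ ((1 : ℝ) / 4 - ε) ≤ max 1 X₀ := by
      calc X ^ ((1 : ℝ) / 4 - ε) ≤ X ^ (1 : ℝ) := Real.rpow_le_rpow_of_exponent_le hX (by linarith)
        _ = X := Real.rpow_one _
        _ ≤ _ := hXX.le.trans (le_max_right _ _)
    calc _ ≤ 1 / max 1 X₀ * max 1 X₀ := mul_le_mul (min_le_right _ _) h1 (by positivity) (by positivity)
      _ = 1 := by field_simp
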